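/- Let $(S_t)_{t\ge 0}$ be a subordinator with zero drift, no killing, and Lévy measure $\nu$ on $(0,\infty)$, that is, a process started at $0$, with independent stationary increments, almost surely nondecreasing right-continuous paths, and $\mathbb E e^{-qS_t}=\exp\bigl(-t\int_{(0,\infty)}(1-e^{-qy})\,\nu(dy)\bigr)$ for $q,t\ge 0$, where $\int\min(1,y)\,\nu(dy)<\infty$. Assume that for some $0<\alpha\le 1$ and some function $\ell$ slowly varying at $\infty$, $$\nu[y,\infty)=\ell(1/y)\,y^{-\alpha}\qquad\text{for all sufficiently small } y>0,$$ and put $\psi(x)=x^{-\alpha}\ell(1/x)$. Let $\phi:[0,\infty)\to[0,1)$ be a diffeomorphism, that is, a continuously differentiable function with $\phi(0)=0$, $\phi(\infty-)=1$ and $\phi'>0$, and suppose that $\sup\phi'<\infty$. Let $\tau$ be a stopping time, that is, a random variable with values in $[0,\infty]$ such that the process $(\tau\wedge t,\ t\ge 0)$ is adapted to the natural filtration of $(S_t)$, and suppose that $\mathbb E\tau<\infty$. For $x>0$ let $\widetilde N_x(\tau)$ be the number of times $u\in[0,\tau]$ (with $u<\infty$) at which the transformed process $(\phi(S_u))$ has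 a jump $\phi(S_u)-\phi(S_{u-})$ of size at least $x$. Then $\widetilde N_x(\tau)$ is almost surely finite for all $x>0$, it and $\int_0^\tau(\phi'(S_u))^\alpha\,du$ are integrable random variables, and $$\frac{\widetilde N_x(\tau)}{\psi(x)}\longrightarrow\int_0^\tau(\phi'(S_u))^\alpha\,du\qquad\text{as } x\downarrow 0,$$ both almost surely and in the mean (that is, in $L^1$). -/

import Mathlib

open MeasureTheory ProbabilityTheory Filter Topology Set
open scoped ENNReal NNReal

/-- `l` is slowly varying at `∞`: it is positive near `∞` and `l (c x) / l x → 1` for every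
`c > 0`. (The usual requirement that `l` be measurable near `∞` is automatic wherever the notion
is used below, as `l (1 / y) = y ^ α ν[y, ∞)` for small `y`.) -/
def SlowlyVarying (l : ℝ → ℝ) : Prop :=
  (∀ᶠ x in atTop, 0 < l x) ∧
    ∀ c : ℝ, 0 < c → Tendsto (fun x => l (c * x) / l x) atTop (𝓝 1)

/-- The scaling function `ψ(x) = x ^ (-α) l(1 / x)`. -/
noncomputable def scaling (α : ℝ) (l : ℝ → ℝ) (x : ℝ) : ℝ :=
  x ^ (-α) * l (1 / x)

/-- The tail of `ν` is regularly varying at `0`: `ν[y, ∞) = l(1 / y) y ^ (-α)` for all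
sufficiently small `y > 0`, where `l` is slowly varying at `∞`. -/
def RegVaryingTail (ν : Measure ℝ) (α : ℝ) (l : ℝ → ℝ) : Prop :=
  SlowlyVarying l ∧ ∀ᶠ y in 𝓝[>] (0 : ℝ), ν (Ici y) = ENNReal.ofReal (scaling α l y)

/-- Lévy measures of subordinators with finite jumps: measures on `(0, ∞)`, viewed as measures on
`ℝ`, with `∫ min(1, y) ν(dy) < ∞`. -/
structure IsSubordinatorLevyMeasure (ν : Measure ℝ) : Prop where
  nonpos_null : ν (Iic 0) = 0
  lintegral_lt_top : ∫⁻ y, ENNReal.ofReal (min 1 y) ∂ν < ∞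

/-- The Laplace exponent `Φ(q) = ∫ (1 - e^{-q y}) ν(dy)` of the driftless subordinator with Lévy
measure `ν`. -/
noncomputable def laplaceExponent (ν : Measure ℝ) (q : ℝ) : ℝ :=
  ∫ y, (1 - Real.exp (-(q * y))) ∂ν

/-- `S` is a subordinator with drift coefficient `0` and Lévy measure `ν` (and no killing): a
process with independent stationary increments, started at `0`, almost surely with nondecreasing
right-continuous paths, and with `E e^{-q S_t} = e^{-t Φ(q)}`. -/
structure IsDriftlessSubordinator {Ω : Type*} [MeasurableSpace Ω] (S : ℝ≥0 → Ω → ℝ)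
    (ν : Measure ℝ) (P : Measure Ω) : Prop where
  levyMeasure : IsSubordinatorLevyMeasure ν
  measurable : ∀ t, Measurable (S t)
  start_zero : ∀ᵐ ω ∂P, S 0 ω = 0
  mono : ∀ᵐ ω ∂P, Monotone (fun t => S t ω)
  rightCont : ∀ᵐ ω ∂P, ∀ t, ContinuousWithinAt (fun u => S u ω) (Ici t) t
  indep : HasIndepIncrements S P
  stationary : ∀ s t, IdentDistrib (fun ω => S (s + t) ω - S s ω) (S t) P P
  laplace : ∀ (t : ℝ≥0) (q : ℝ), 0 ≤ q →
    ∫ ω, Real.exp (-(q * S t ω)) ∂P = Real.exp (-((t : ℝ) * laplaceExponent ν q))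

/-- The natural filtration `σ(S_s, s ≤ t)` of a subordinator. -/
def IsDriftlessSubordinator.filtration {Ω : Type*} [mΩ : MeasurableSpace Ω] {S : ℝ≥0 → Ω → ℝ}
    {ν : Measure ℝ} {P : Measure Ω} (hS : IsDriftlessSubordinator S ν P) : Filtration ℝ≥0 mΩ :=
  Filtration.natural S (fun t => (hS.measurable t).stronglyMeasurable)

/-- A `[0, ∞]`-valued `τ` is a stopping time if the process `(τ ∧ t, t ≥ 0)` is adapted. -/
def IsTruncStoppingTime {Ω : Type*} [mΩ : MeasurableSpace Ω] (F : Filtration ℝ≥0 mΩ)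
    (τ : Ω → ℝ≥0∞) : Prop :=
  ∀ t : ℝ≥0, Measurable[F t] (fun ω => min (τ ω) (t : ℝ≥0∞))

/-- The derivative of a function on `[0, ∞)` (one-sided at `0`). -/
noncomputable def halfLineDeriv (φ : ℝ → ℝ) (y : ℝ) : ℝ :=
  derivWithin φ (Ici 0) y

/-- `φ : [0, ∞) → [0, 1)` is a diffeomorphism: continuously differentiable with `φ(0) = 0`,
`φ(∞-) = 1` and `φ' > 0`. The values of `φ` on `(-∞, 0)` are irrelevant. -/
structure IsHalfLineDiffeo (φ : ℝ → ℝ) : Prop where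
  contDiffOn : ContDiffOn ℝ 1 φ (Ici 0)
  map_zero : φ 0 = 0
  tendsto_one : Tendsto φ atTop (𝓝 1)
  deriv_pos : ∀ y, 0 ≤ y → 0 < halfLineDeriv φ y

/-- The times `u ≤ T` at which the path `f` has a jump `f(u) - f(u-)` of size at least `x`. -/
def jumpTimes (f : ℝ≥0 → ℝ) (x : ℝ) (T : ℝ≥0∞) : Set ℝ≥0 :=
  {u | (u : ℝ≥0∞) ≤ T ∧ x ≤ f u - Function.leftLim f u}

/-- The number `Ñ_x(T)` of jumps of size at least `x` up to time `T` of the transformed path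
`φ(S)`. -/
noncomputable def gapCount (φ : ℝ → ℝ) (s : ℝ≥0 → ℝ) (x : ℝ) (T : ℝ≥0∞) : ℕ :=
  (jumpTimes (fun u => φ (s u)) x T).ncard

/-- The integral `∫_0^T φ'(S_u)^α du` along the path `s` of `S`, for `T < ∞`. -/
noncomputable def gapLimit (φ : ℝ → ℝ) (α : ℝ) (s : ℝ≥0 → ℝ) (T : ℝ≥0∞) : ℝ :=
  ∫ u in (0 : ℝ)..T.toReal, halfLineDeriv φ (s u.toNNReal) ^ α

/-! Write N_x(t) for the number of jumps of S of size at least x up to time t. The core is the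
strong law `ae_tendsto_ncard_jumpTimes`: almost surely N_x(t)/ψ(x) → t for all t. Everything about
N_x is read off dyadic increments. For a nondecreasing right-continuous path, the number of
increments of length 2^{-n} that are at least x is eventually the number of jumps at least x
(`eventually_encard_gridJumps`). The Laplace transform gives 2^n P(S_{2^{-n}} ≥ x) → ν[x,∞) at
continuity points of the tail (`tendsto_two_pow_mul`), through moment convergence of weighted images
of the laws under y ↦ e^{-y}. The dyadic count is a sum of independent indicators, so Fatou yields
E(N_x(t) − tν[x,∞))² ≤ tν[x,∞) (`lintegral_sq_jumpTimes_le`). Along geometric sequences of levels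
these errors, divided by ν[x,∞)², are summable. This gives almost sure convergence there, and
monotonicity in x fills the gaps (`tendsto_div_of_geometric`).

The passage to φ(S) is pathwise (`tendsto_gapCount_div`). On a time interval where φ' ranges over
[m, M] along the path, a jump of φ(S) is between m and M times the jump of S. Its counts are
therefore squeezed between those of S at levels x/m and x/M, and regular variation turns these
levels into factors m^α and M^α. Summing over a fine partition produces the integral of φ'(S_u)^α.

For the mean, C ≥ sup φ' bounds the count of φ(S) by N_{x/C}(τ). The event {t ≤ τ} belongs to the
past of t, so a Wald argument on the grid gives E N_x(τ) ≤ ν[x,∞) Eτ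
(`lintegral_encard_jumpTimes_le`). The dominating variables N_{x/C}(τ)/ψ(x) converge almost surely
to C^α τ, and the limit superior of their means is at most C^α Eτ. Dominated convergence with
varying bounds (`tendsto_integral_abs_sub_of_le`) then applies. -/

/-! ### Counting the jumps of a monotone path on dyadic grids. -/

/-- The dyadic point `k / 2 ^ n`. -/
noncomputable def dyadicPt (n k : ℕ) : ℝ≥0 := k / 2 ^ n

/-- The index `k` of the dyadic interval `(k / 2 ^ n, (k + 1) / 2 ^ n]` that contains `u > 0`. -/
noncomputable def dyadicIdx (n : ℕ) (u : ℝ≥0) : ℕ := ⌈u * 2 ^ n⌉₊ - 1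

/-- The indices of the dyadic intervals started up to time `T` on which `f` increases by at least
`x`. -/
def gridJumps (f : ℝ≥0 → ℝ) (x : ℝ) (T : ℝ≥0∞) (n : ℕ) : Set ℕ :=
  {k | (dyadicPt n k : ℝ≥0∞) ≤ T ∧ x ≤ f (dyadicPt n (k + 1)) - f (dyadicPt n k)}

lemma dyadicPt_succ (n k : ℕ) : dyadicPt n (k + 1) = dyadicPt n k + (2 ^ n)⁻¹ := by
  simp [dyadicPt, add_div]

lemma dyadicPt_mono (n : ℕ) : Monotone (dyadicPt n) := by
  intro a b h
  simp only [dyadicPt]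
  gcongr

lemma dyadicIdx_add_one {n : ℕ} {u : ℝ≥0} (hu : 0 < u) :
    dyadicIdx n u + 1 = ⌈u * 2 ^ n⌉₊ := by
  have : 0 < ⌈u * 2 ^ n⌉₊ := Nat.ceil_pos.2 (by positivity)
  simp only [dyadicIdx]
  omega

lemma dyadicPt_dyadicIdx_lt {n : ℕ} {u : ℝ≥0} (hu : 0 < u) : dyadicPt n (dyadicIdx n u) < u := by
  rw [dyadicPt, div_lt_iff₀ (by positivity)]
  have h := Nat.ceil_lt_add_one (zero_le (a := u * 2 ^ n))
  rw [← dyadicIdx_add_one hu] at h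
  push_cast at h
  exact lt_of_add_lt_add_right h

lemma le_dyadicPt_dyadicIdx {n : ℕ} {u : ℝ≥0} (hu : 0 < u) :
    u ≤ dyadicPt n (dyadicIdx n u + 1) := by
  rw [dyadicPt, le_div_iff₀ (by positivity), dyadicIdx_add_one hu]
  exact Nat.le_ceil _

lemma dyadicIdx_eq {n k : ℕ} {u : ℝ≥0} (h₁ : dyadicPt n k < u) (h₂ : u ≤ dyadicPt n (k + 1)) :
    dyadicIdx n u = k := by
  have hu : 0 < u := (zero_le).trans_lt h₁
  rw [dyadicPt, div_lt_iff₀ (by positivity)] at h₁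
  rw [dyadicPt, le_div_iff₀ (by positivity)] at h₂
  have : ⌈u * 2 ^ n⌉₊ = k + 1 := by
    rw [Nat.ceil_eq_iff (by omega)]
    exact ⟨by simpa using h₁, by simpa using h₂⟩
  simp [dyadicIdx, this]

lemma tendsto_two_pow_inv : Tendsto (fun n : ℕ => ((2 : ℝ≥0) ^ n)⁻¹) atTop (𝓝 0) := by
  simp_rw [← inv_pow]
  exact NNReal.tendsto_pow_atTop_nhds_zero_of_lt_one (by rw [← NNReal.coe_lt_coe]; norm_num)

lemma pos_of_mem_jumpTimes {f : ℝ≥0 → ℝ} {x : ℝ} (hx : 0 < x) {T : ℝ≥0∞} {u : ℝ≥0}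
    (hu : u ∈ jumpTimes f x T) : 0 < u := by
  rcases eq_or_ne u 0 with rfl | h
  · have := hu.2
    rw [leftLim_eq_of_isBot (a := (0 : ℝ≥0)) fun _ => zero_le] at this
    linarith
  · exact pos_iff_ne_zero.2 h

/-- The intervals are open on the left, so the left endpoint lies strictly before the jump time and
the increment contains the whole jump. -/
lemma dyadicIdx_mem_gridJumps {f : ℝ≥0 → ℝ} (hf : Monotone f) {x : ℝ} (hx : 0 < x) {T : ℝ≥0∞}
    {u : ℝ≥0} (hu : u ∈ jumpTimes f x T) (n : ℕ) : dyadicIdx n u ∈ gridJumps f x T n := by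
  have h0 := pos_of_mem_jumpTimes hx hu
  have h1 := dyadicPt_dyadicIdx_lt (n := n) h0
  refine ⟨le_trans (by exact_mod_cast h1.le) hu.1, ?_⟩
  have h2 := hf.le_leftLim h1
  have h3 := hf (le_dyadicPt_dyadicIdx (n := n) h0)
  linarith [hu.2]

lemma eventually_injOn_dyadicIdx {A : Set ℝ≥0} (hA : A.Finite) (h0 : ∀ u ∈ A, 0 < u) :
    ∀ᶠ n in atTop, InjOn (dyadicIdx n) A := by
  have key : ∀ u ∈ A, ∀ v ∈ A, ∀ᶠ n in atTop, dyadicIdx n u = dyadicIdx n v → u = v := by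
    have aux : ∀ u ∈ A, ∀ v ∈ A, u < v → ∀ᶠ n in atTop, dyadicIdx n u ≠ dyadicIdx n v := by
      intro u hu v hv huv
      filter_upwards [tendsto_two_pow_inv.eventually_lt_const (tsub_pos_of_lt huv)] with n hn h
      have h1 := dyadicPt_dyadicIdx_lt (n := n) (h0 u hu)
      have h2 := le_dyadicPt_dyadicIdx (n := n) (h0 v hv)
      rw [← h, dyadicPt_succ] at h2
      rw [lt_tsub_iff_left] at hn
      exact absurd ((h2.trans_lt (add_lt_add_left h1 _)).trans hn) (lt_irrefl _)
    intro u hu v hv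
    rcases lt_trichotomy u v with h | h | h
    · filter_upwards [aux u hu v hv h] with n hn h'
      exact absurd h' hn
    · exact Eventually.of_forall fun _ _ => h
    · filter_upwards [aux v hv u hu h] with n hn h'
      exact absurd h'.symm hn
  have : ∀ᶠ n in atTop, ∀ u ∈ A, ∀ v ∈ A, dyadicIdx n u = dyadicIdx n v → u = v := by
    rw [eventually_all_finite hA]
    intro u hu
    rw [eventually_all_finite hA]
    exact key u hu
  filter_upwards [this] with n hn u hu v hv h using hn u hu v hv h

lemma finite_setOf_dyadicPt_le (n : ℕ) (T : ℝ≥0) : {k | (dyadicPt n k : ℝ≥0∞) ≤ T}.Finite := by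
  refine (finite_Iic ⌊T * 2 ^ n⌋₊).subset fun k hk => ?_
  have hk' : dyadicPt n k ≤ T := by exact_mod_cast (hk : (dyadicPt n k : ℝ≥0∞) ≤ T)
  rw [dyadicPt, div_le_iff₀ (by positivity)] at hk'
  exact Nat.le_floor hk'

lemma finite_gridJumps (f : ℝ≥0 → ℝ) (x : ℝ) (T : ℝ≥0) (n : ℕ) : (gridJumps f x T n).Finite :=
  (finite_setOf_dyadicPt_le n T).subset fun _ hk => hk.1

/-- Increments of a monotone path telescope. The point is that the bound does not depend on `n`. -/
lemma ncard_gridJumps_mul_le {f : ℝ≥0 → ℝ} (hf : Monotone f) (x : ℝ) (T : ℝ≥0)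
    (n : ℕ) : (gridJumps f x T n).ncard * x ≤ f (T + 1) - f 0 := by
  set m := ⌊T * 2 ^ n⌋₊
  set B := (finite_gridJumps f x T n).toFinset
  have hB : B ⊆ Finset.range (m + 1) := by
    intro k hk
    have hk1 : (dyadicPt n k : ℝ≥0∞) ≤ T := ((finite_gridJumps f x T n).mem_toFinset.1 hk).1
    have hk' : dyadicPt n k ≤ T := by exact_mod_cast hk1
    rw [dyadicPt, div_le_iff₀ (by positivity)] at hk'
    exact Finset.mem_range.2 (Nat.lt_succ_of_le (Nat.le_floor hk'))
  have h1 : ∑ k ∈ B, x ≤ ∑ k ∈ B, (f (dyadicPt n (k + 1)) - f (dyadicPt n k)) :=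
    Finset.sum_le_sum fun k hk => ((finite_gridJumps f x T n).mem_toFinset.1 hk).2
  have h2 : ∑ k ∈ B, (f (dyadicPt n (k + 1)) - f (dyadicPt n k)) ≤
      ∑ k ∈ Finset.range (m + 1), (f (dyadicPt n (k + 1)) - f (dyadicPt n k)) :=
    Finset.sum_le_sum_of_subset_of_nonneg hB fun k _ _ =>
      sub_nonneg.2 (hf (dyadicPt_mono n k.le_succ))
  rw [Finset.sum_range_sub (fun k => f (dyadicPt n k))] at h2
  -- The last interval starts by time `T` but may overrun it, by at most 2^{-n} ≤ 1.
  have h3 : dyadicPt n (m + 1) ≤ T + 1 := by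
    rw [dyadicPt_succ]
    gcongr
    · rw [dyadicPt, div_le_iff₀ (by positivity)]
      exact Nat.floor_le zero_le
    · exact inv_le_one_of_one_le₀ (one_le_pow₀ (by norm_num))
  have h4 : dyadicPt n 0 = 0 := by simp [dyadicPt]
  rw [h4] at h2
  rw [ncard_eq_toFinset_card _ (finite_gridJumps f x T n)]
  simp only [Finset.sum_const, nsmul_eq_mul] at h1
  linarith [hf h3]

lemma finite_jumpTimes {f : ℝ≥0 → ℝ} (hf : Monotone f) {x : ℝ} (hx : 0 < x) (T : ℝ≥0) :
    (jumpTimes f x T).Finite := by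
  by_contra hinf
  obtain ⟨A, hA, hAc⟩ := (show (jumpTimes f x T).Infinite from hinf).exists_subset_card_eq
    (⌊(f (T + 1) - f 0) / x⌋₊ + 1)
  obtain ⟨n, hn⟩ := (eventually_injOn_dyadicIdx A.finite_toSet
    fun u hu => pos_of_mem_jumpTimes hx (hA hu)).exists
  have h1 : (A : Set ℝ≥0).ncard ≤ (gridJumps f x T n).ncard :=
    ncard_le_ncard_of_injOn (dyadicIdx n) (fun u hu => dyadicIdx_mem_gridJumps hf hx (hA hu) n) hn
      (finite_gridJumps f x T n)
  rw [ncard_coe_finset, hAc] at h1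
  have h2 := ncard_gridJumps_mul_le hf x T n
  have h3 : ((gridJumps f x T n).ncard : ℝ) ≤ (f (T + 1) - f 0) / x := by
    rwa [le_div_iff₀ hx]
  have h4 := Nat.lt_floor_add_one ((f (T + 1) - f 0) / x)
  have h5 : ((⌊(f (T + 1) - f 0) / x⌋₊ + 1 : ℕ) : ℝ) ≤ (gridJumps f x T n).ncard := by
    exact_mod_cast h1
  push_cast at h5
  linarith

/-- Compactness: along the ultrafilter the chosen intervals shrink to a point u ≤ T. If both
endpoints stay on the same side of u, the increments tend to 0, which contradicts x > 0. Hence the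
intervals straddle u, and their increments tend to the jump at u. -/
lemma mem_image_dyadicIdx_of_ultrafilter {f : ℝ≥0 → ℝ} (hf : Monotone f)
    (hr : ∀ t, ContinuousWithinAt f (Ici t) t) {x : ℝ} (hx : 0 < x) {T : ℝ≥0}
    {U : Ultrafilter ℕ} (hU : (U : Filter ℕ) ≤ atTop) {k : ℕ → ℕ}
    (hk : ∀ᶠ n in U, k n ∈ gridJumps f x T n) :
    ∀ᶠ n in U, k n ∈ dyadicIdx n '' jumpTimes f x T := by
  set a : ℕ → ℝ≥0 := fun n => dyadicPt n (k n) with ha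
  set b : ℕ → ℝ≥0 := fun n => dyadicPt n (k n + 1) with hb
  have hab : ∀ n, a n ≤ b n := fun n => dyadicPt_mono n (k n).le_succ
  have haT : ∀ᶠ n in U, a n ∈ Icc 0 T := by
    filter_upwards [hk] with n hn
    exact ⟨zero_le, by exact_mod_cast hn.1⟩
  obtain ⟨u, huT, hu⟩ := (isCompact_Icc (a := (0 : ℝ≥0)) (b := T)).ultrafilter_le_nhds'
    (U.map a) haT
  have hau : Tendsto a U (𝓝 u) := hu
  have hbu : Tendsto b U (𝓝 u) := by
    have := hau.add (tendsto_two_pow_inv.mono_left hU)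
    rw [add_zero] at this
    exact this.congr fun n => (dyadicPt_succ n (k n)).symm
  have hxU : ∀ᶠ n in U, x ≤ f (b n) - f (a n) := hk.mono fun n hn => hn.2
  have right : ∀ c : ℕ → ℝ≥0, Tendsto c U (𝓝 u) → (∀ᶠ n in U, u ≤ c n) →
      Tendsto (fun n => f (c n)) U (𝓝 (f u)) := fun c hc h =>
    (hr u).tendsto.comp (tendsto_nhdsWithin_iff.2 ⟨hc, h⟩)
  have left : ∀ c : ℕ → ℝ≥0, Tendsto c U (𝓝 u) → (∀ᶠ n in U, c n < u) →
      Tendsto (fun n => f (c n)) U (𝓝 (Function.leftLim f u)) := fun c hc h =>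
    (hf.tendsto_leftLim u).comp (tendsto_nhdsWithin_iff.2 ⟨hc, h⟩)
  rcases U.eventually_or.1 (Eventually.of_forall fun n => lt_or_ge (a n) u) with h1 | h1
  · rcases U.eventually_or.1 (Eventually.of_forall fun n => lt_or_ge (b n) u) with h2 | h2
    · have := ge_of_tendsto ((left b hbu h2).sub (left a hau h1)) hxU
      linarith
    · have := ge_of_tendsto ((right b hbu h2).sub (left a hau h1)) hxU
      filter_upwards [h1, h2] with n hn1 hn2
      exact ⟨u, ⟨by exact_mod_cast huT.2, this⟩, dyadicIdx_eq hn1 hn2⟩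
  · have h2 : ∀ᶠ n in U, u ≤ b n := h1.mono fun n hn => hn.trans (hab n)
    have := ge_of_tendsto ((right b hbu h2).sub (right a hau h1)) hxU
    linarith

/-- For a nondecreasing right-continuous path, the number of dyadic increments of size at least `x`
is eventually the number of jumps of size at least `x`. -/
lemma eventually_encard_gridJumps {f : ℝ≥0 → ℝ} (hf : Monotone f)
    (hr : ∀ t, ContinuousWithinAt f (Ici t) t) {x : ℝ} (hx : 0 < x) (T : ℝ≥0) :
    ∀ᶠ n in atTop, (gridJumps f x T n).encard = (jumpTimes f x T).encard := by
  have hsurj : ∀ᶠ n in atTop, gridJumps f x T n ⊆ dyadicIdx n '' jumpTimes f x T := by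
    by_contra hcon
    simp only [not_eventually, not_subset] at hcon
    set B : Set ℕ := {n | ∃ k ∈ gridJumps f x T n, k ∉ dyadicIdx n '' jumpTimes f x T} with hB
    have : ∀ n, ∃ k, n ∈ B → k ∈ gridJumps f x T n ∧ k ∉ dyadicIdx n '' jumpTimes f x T := by
      intro n
      by_cases h : n ∈ B
      · obtain ⟨k, hk⟩ := h
        exact ⟨k, fun _ => hk⟩
      · exact ⟨0, fun h' => absurd h' h⟩
    choose k hk using this
    -- An ultrafilter concentrated on the bad `n` replaces the extraction of subsequences, and also
    -- decides on which side of the limit each endpoint lies.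
    have hne : (atTop ⊓ 𝓟 B).NeBot := frequently_mem_iff_neBot.1 hcon
    set U := Ultrafilter.of (atTop ⊓ 𝓟 B)
    have hU : (U : Filter ℕ) ≤ atTop ⊓ 𝓟 B := Ultrafilter.of_le _
    have hBU : ∀ᶠ n in U, n ∈ B := le_principal_iff.1 (hU.trans inf_le_right)
    have h := mem_image_dyadicIdx_of_ultrafilter hf hr hx (hU.trans inf_le_left) (k := k) (T := T)
      (hBU.mono fun n hn => (hk n hn).1)
    obtain ⟨n, hn1, hn2⟩ := (hBU.and h).exists
    exact (hk n hn1).2 hn2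
  filter_upwards [hsurj, eventually_injOn_dyadicIdx (finite_jumpTimes hf hx T)
    fun u hu => pos_of_mem_jumpTimes hx hu] with n h1 h2
  have h3 : gridJumps f x T n = dyadicIdx n '' jumpTimes f x T :=
    h1.antisymm (image_subset_iff.2 fun u hu => dyadicIdx_mem_gridJumps hf hx hu n)
  rw [h3, h2.encard_image]

/-! ### Regular variation and the pathwise passage from S to φ(S). -/

/-- A continuous function on a compact interval is Lipschitz up to an arbitrarily small error. -/
lemma exists_abs_sub_le_add_mul {G : ℝ → ℝ} {R : ℝ} (hG : ContinuousOn G (Icc 0 R)) {ε : ℝ}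
    (hε : 0 < ε) : ∃ K, 0 ≤ K ∧ ∀ p ∈ Icc 0 R, ∀ q ∈ Icc 0 R, |G p - G q| ≤ ε + K * |p - q| := by
  obtain ⟨C, hC⟩ := isCompact_Icc.exists_bound_of_continuousOn hG
  obtain ⟨δ, hδ, h⟩ := Metric.uniformContinuousOn_iff.1
    (isCompact_Icc.uniformContinuousOn_of_continuous hG) ε hε
  -- Points closer than `δ` are handled by uniform continuity; beyond `δ` this slope already exceeds
  -- the oscillation bound 2|C|.
  refine ⟨2 * |C| / δ, by positivity, fun p hp q hq => ?_⟩
  rcases lt_or_ge (dist p q) δ with hd | hd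
  · have h1 := (h p hp q hq hd).le
    rw [Real.dist_eq] at h1
    have : 0 ≤ 2 * |C| / δ * |p - q| := by positivity
    linarith
  · have h1 : |G p - G q| ≤ 2 * |C| := by
      have h2 := hC p hp
      have h3 := hC q hq
      rw [Real.norm_eq_abs] at h2 h3
      have := abs_sub (G p) (G q)
      linarith [le_abs_self C]
    have h2 : 2 * |C| ≤ 2 * |C| / δ * |p - q| := by
      rw [div_mul_eq_mul_div, le_div_iff₀ hδ]
      exact mul_le_mul_of_nonneg_left (by rwa [Real.dist_eq] at hd) (by positivity)
    linarith

lemma tendsto_const_mul_nhdsGT {c : ℝ} (hc : 0 < c) :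
    Tendsto (fun x => c * x) (𝓝[>] 0) (𝓝[>] 0) := by
  refine tendsto_nhdsWithin_iff.2 ⟨?_, ?_⟩
  · have : Tendsto (fun x : ℝ => c * x) (𝓝 0) (𝓝 (c * 0)) := (continuous_const_mul c).tendsto 0
    rw [mul_zero] at this
    exact this.mono_left nhdsWithin_le_nhds
  · filter_upwards [self_mem_nhdsWithin] with x hx using mul_pos hc hx

lemma SlowlyVarying.eventually_scaling_pos {l : ℝ → ℝ} (hl : SlowlyVarying l) (α : ℝ) :
    ∀ᶠ x in 𝓝[>] 0, 0 < scaling α l x := by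
  filter_upwards [tendsto_inv_nhdsGT_zero.eventually hl.1, self_mem_nhdsWithin] with x hx hx0
  have hx0' : (0 : ℝ) < x := hx0
  rw [scaling, one_div]
  exact mul_pos (Real.rpow_pos_of_pos hx0' _) hx

lemma SlowlyVarying.tendsto_scaling_div {l : ℝ → ℝ} (hl : SlowlyVarying l) (α : ℝ) {c : ℝ}
    (hc : 0 < c) :
    Tendsto (fun x => scaling α l (c * x) / scaling α l x) (𝓝[>] 0) (𝓝 (c ^ (-α))) := by
  have h1 := ((hl.2 c⁻¹ (inv_pos.2 hc)).comp tendsto_inv_nhdsGT_zero).const_mul (c ^ (-α))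
  rw [mul_one] at h1
  refine h1.congr' ?_
  filter_upwards [self_mem_nhdsWithin] with x hx
  have hx' : (0 : ℝ) < x := hx
  have h2 : x ^ (-α) ≠ 0 := (Real.rpow_pos_of_pos hx' _).ne'
  simp only [Function.comp, scaling, one_div, mul_inv]
  rw [Real.mul_rpow hc.le hx'.le]
  field_simp

lemma IsHalfLineDiffeo.continuousOn_deriv {φ : ℝ → ℝ} (hφ : IsHalfLineDiffeo φ) :
    ContinuousOn (halfLineDeriv φ) (Ici 0) :=
  hφ.contDiffOn.continuousOn_derivWithin (uniqueDiffOn_Ici 0) le_rfl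

lemma halfLineDeriv_eq_deriv (φ : ℝ → ℝ) {y : ℝ} (hy : 0 < y) :
    halfLineDeriv φ y = deriv φ y :=
  derivWithin_of_mem_nhds (Ici_mem_nhds hy)

lemma IsHalfLineDiffeo.differentiableOn_interior_Icc {φ : ℝ → ℝ} (hφ : IsHalfLineDiffeo φ)
    {p q : ℝ} (hp : 0 ≤ p) : DifferentiableOn ℝ φ (interior (Icc p q)) := by
  refine (hφ.contDiffOn.differentiableOn one_ne_zero).mono ?_
  rw [interior_Icc]
  exact fun y hy => hp.trans hy.1.le

lemma IsHalfLineDiffeo.sub_le {φ : ℝ → ℝ} (hφ : IsHalfLineDiffeo φ) {p q p' q' M : ℝ}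
    (hp : 0 ≤ p) (hM : ∀ y ∈ Icc p q, halfLineDeriv φ y ≤ M) (h1 : p ≤ p') (h2 : p' ≤ q')
    (h3 : q' ≤ q) : φ q' - φ p' ≤ M * (q' - p') := by
  refine (convex_Icc p q).image_sub_le_mul_sub_of_deriv_le
    (hφ.contDiffOn.continuousOn.mono fun y hy => hp.trans hy.1)
    (hφ.differentiableOn_interior_Icc hp) (fun y hy => ?_) p' ⟨h1, h2.trans h3⟩ q'
    ⟨h1.trans h2, h3⟩ h2
  rw [interior_Icc] at hy
  rw [← halfLineDeriv_eq_deriv φ (hp.trans_lt hy.1)]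
  exact hM y (Ioo_subset_Icc_self hy)

lemma IsHalfLineDiffeo.le_sub {φ : ℝ → ℝ} (hφ : IsHalfLineDiffeo φ) {p q p' q' m : ℝ}
    (hp : 0 ≤ p) (hm : ∀ y ∈ Icc p q, m ≤ halfLineDeriv φ y) (h1 : p ≤ p') (h2 : p' ≤ q')
    (h3 : q' ≤ q) : m * (q' - p') ≤ φ q' - φ p' := by
  refine (convex_Icc p q).mul_sub_le_image_sub_of_le_deriv
    (hφ.contDiffOn.continuousOn.mono fun y hy => hp.trans hy.1)
    (hφ.differentiableOn_interior_Icc hp) (fun y hy => ?_) p' ⟨h1, h2.trans h3⟩ q'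
    ⟨h1.trans h2, h3⟩ h2
  rw [interior_Icc] at hy
  rw [← halfLineDeriv_eq_deriv φ (hp.trans_lt hy.1)]
  exact hm y (Ioo_subset_Icc_self hy)

lemma IsHalfLineDiffeo.monotoneOn {φ : ℝ → ℝ} (hφ : IsHalfLineDiffeo φ) :
    MonotoneOn φ (Ici 0) := by
  intro p hp q _ hpq
  have := hφ.le_sub (m := 0) hp (fun y hy => (hφ.deriv_pos y (le_trans hp hy.1)).le) le_rfl hpq
    le_rfl
  linarith

/-- The sample paths of a subordinator outside a null set: nondecreasing and right-continuous
functions started at `0`. -/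
structure IsSubordinatorPath (s : ℝ≥0 → ℝ) : Prop where
  mono : Monotone s
  rightCont : ∀ t, ContinuousWithinAt s (Ici t) t
  zero : s 0 = 0

namespace IsSubordinatorPath

variable {s : ℝ≥0 → ℝ} {φ : ℝ → ℝ}

lemma nonneg (hs : IsSubordinatorPath s) (u : ℝ≥0) : 0 ≤ s u := hs.zero ▸ hs.mono zero_le

lemma mono_comp (hs : IsSubordinatorPath s) (hφ : IsHalfLineDiffeo φ) :
    Monotone (fun u => φ (s u)) :=
  fun u v h => hφ.monotoneOn (hs.nonneg u) (hs.nonneg v) (hs.mono h)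

lemma rightCont_comp (hs : IsSubordinatorPath s) (hφ : IsHalfLineDiffeo φ) (t : ℝ≥0) :
    ContinuousWithinAt (fun u => φ (s u)) (Ici t) t :=
  (hφ.contDiffOn.continuousOn (s t) (hs.nonneg t)).comp (hs.rightCont t) fun u _ => hs.nonneg u

lemma leftLim_comp (hs : IsSubordinatorPath s) (hφ : IsHalfLineDiffeo φ) {u : ℝ≥0} (hu : 0 < u) :
    Function.leftLim (fun u => φ (s u)) u = φ (Function.leftLim s u) := by
  have : (𝓝[<] u).NeBot := nhdsLT_neBot_of_exists_lt ⟨0, hu⟩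
  have h0 : 0 ≤ Function.leftLim s u := (hs.nonneg 0).trans (hs.mono.le_leftLim hu)
  refine leftLim_eq_of_tendsto ?_
  exact (hφ.contDiffOn.continuousOn _ h0).tendsto.comp
    (tendsto_nhdsWithin_iff.2 ⟨hs.mono.tendsto_leftLim u, Eventually.of_forall hs.nonneg⟩)

lemma finite_jumpTimes_comp (hs : IsSubordinatorPath s) (hφ : IsHalfLineDiffeo φ) {x : ℝ}
    (hx : 0 < x) (T : ℝ≥0) : (jumpTimes (fun u => φ (s u)) x T).Finite :=
  finite_jumpTimes (hs.mono_comp hφ) hx T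

end IsSubordinatorPath

lemma jumpTimes_zero (f : ℝ≥0 → ℝ) {x : ℝ} (hx : 0 < x) :
    jumpTimes f x ((0 : ℝ≥0) : ℝ≥0∞) = ∅ := by
  refine eq_empty_of_forall_notMem fun u hu => ?_
  have h1 := pos_of_mem_jumpTimes hx hu
  have h2 : u ≤ 0 := by exact_mod_cast hu.1
  exact absurd h1 (not_lt.2 h2)

/-- The number of jumps of size at least `x` in the time interval `(a, b]`, as a difference. -/
lemma ncard_jumpTimes_sdiff {f : ℝ≥0 → ℝ} {x : ℝ} {a b : ℝ≥0}
    (hfin : (jumpTimes f x b).Finite) (hab : a ≤ b) :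
    ((jumpTimes f x b \ jumpTimes f x a).ncard : ℝ) =
      (jumpTimes f x b).ncard - (jumpTimes f x a).ncard := by
  have hsub : jumpTimes f x a ⊆ jumpTimes f x b :=
    fun u hu => ⟨hu.1.trans (by exact_mod_cast hab), hu.2⟩
  rw [ncard_sdiff hsub (hfin.subset hsub), Nat.cast_sub (ncard_le_ncard hsub hfin)]

lemma jumpTimes_sdiff (f : ℝ≥0 → ℝ) (x : ℝ) (a b : ℝ≥0) :
    jumpTimes f x b \ jumpTimes f x a = {u | a < u ∧ u ≤ b ∧ x ≤ f u - Function.leftLim f u} := by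
  ext u
  simp only [jumpTimes, Set.mem_sdiff, mem_ofPred_eq, ENNReal.coe_le_coe, not_and]
  constructor
  · rintro ⟨⟨h1, h2⟩, h3⟩
    exact ⟨not_le.1 fun h => h3 h h2, h1, h2⟩
  · rintro ⟨h1, h2, h3⟩
    exact ⟨⟨h2, h3⟩, fun h => absurd h (not_le.2 h1)⟩

section Increments

variable {s : ℝ≥0 → ℝ} {φ : ℝ → ℝ} (hs : IsSubordinatorPath s) (hφ : IsHalfLineDiffeo φ)
include hs hφ

/-- By the mean value inequality, a jump of φ(s) of size at least x forces a jump of s of size at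
least x/M. -/
lemma jumpTimes_comp_sub_le {x : ℝ} (hx : 0 < x) {a b : ℝ≥0} (hab : a ≤ b) {M : ℝ} (hM0 : 0 < M)
    (hM : ∀ y ∈ Icc (s a) (s b), halfLineDeriv φ y ≤ M) :
    ((jumpTimes (fun u => φ (s u)) x b).ncard : ℝ) - (jumpTimes (fun u => φ (s u)) x a).ncard ≤
      (jumpTimes s (M⁻¹ * x) b).ncard - (jumpTimes s (M⁻¹ * x) a).ncard := by
  have hfin := finite_jumpTimes hs.mono (mul_pos (inv_pos.2 hM0) hx) b
  rw [← ncard_jumpTimes_sdiff (hs.finite_jumpTimes_comp hφ hx b) hab,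
    ← ncard_jumpTimes_sdiff hfin hab]
  refine Nat.cast_le.2 (ncard_le_ncard ?_ (hfin.subset sdiff_subset))
  rw [jumpTimes_sdiff, jumpTimes_sdiff]
  rintro u ⟨h1, h2, h3⟩
  rw [hs.leftLim_comp hφ (zero_le.trans_lt h1)] at h3
  have := hφ.sub_le (hs.nonneg a) hM (hs.mono.le_leftLim h1) (hs.mono.leftLim_le le_rfl)
    (hs.mono h2)
  refine ⟨h1, h2, ?_⟩
  rw [inv_mul_le_iff₀ hM0]
  linarith

lemma le_jumpTimes_comp_sub {x : ℝ} (hx : 0 < x) {a b : ℝ≥0} (hab : a ≤ b) {m : ℝ} (hm0 : 0 < m)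
    (hm : ∀ y ∈ Icc (s a) (s b), m ≤ halfLineDeriv φ y) :
    ((jumpTimes s (m⁻¹ * x) b).ncard : ℝ) - (jumpTimes s (m⁻¹ * x) a).ncard ≤
      (jumpTimes (fun u => φ (s u)) x b).ncard - (jumpTimes (fun u => φ (s u)) x a).ncard := by
  have hfin := hs.finite_jumpTimes_comp hφ hx b
  rw [← ncard_jumpTimes_sdiff hfin hab,
    ← ncard_jumpTimes_sdiff (finite_jumpTimes hs.mono (mul_pos (inv_pos.2 hm0) hx) b) hab]
  refine Nat.cast_le.2 (ncard_le_ncard ?_ (hfin.subset sdiff_subset))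
  rw [jumpTimes_sdiff, jumpTimes_sdiff]
  rintro u ⟨h1, h2, h3⟩
  refine ⟨h1, h2, ?_⟩
  rw [hs.leftLim_comp hφ (zero_le.trans_lt h1)]
  have := hφ.le_sub (hs.nonneg a) hm (hs.mono.le_leftLim h1) (hs.mono.leftLim_le le_rfl)
    (hs.mono h2)
  rw [inv_mul_le_iff₀ hm0] at h3
  linarith

end Increments

lemma IsHalfLineDiffeo.continuousOn_rpow_deriv {φ : ℝ → ℝ} (hφ : IsHalfLineDiffeo φ) (α : ℝ) :
    ContinuousOn (fun y => halfLineDeriv φ y ^ α) (Ici 0) :=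
  hφ.continuousOn_deriv.rpow_const fun y hy => Or.inl (hφ.deriv_pos y hy).ne'

lemma IsSubordinatorPath.intervalIntegrable {s : ℝ≥0 → ℝ} (hs : IsSubordinatorPath s)
    {φ : ℝ → ℝ} (hφ : IsHalfLineDiffeo φ) (α : ℝ) (a b : ℝ) :
    IntervalIntegrable (fun u : ℝ => halfLineDeriv φ (s u.toNNReal) ^ α) volume a b := by
  -- Measurability comes from a monotone path composed with a continuous function; the truncation
  -- `max y 0` supplies a function continuous on all of ℝ.
  have hmono : Monotone fun u : ℝ => s u.toNNReal := fun _ _ h => hs.mono (Real.toNNReal_mono h)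
  have hcont : Continuous fun y : ℝ => halfLineDeriv φ (max y 0) ^ α :=
    (hφ.continuousOn_rpow_deriv α).comp_continuous (continuous_id.max continuous_const)
      fun y => mem_Ici.2 (le_max_right _ _)
  have heq : (fun u : ℝ => halfLineDeriv φ (s u.toNNReal) ^ α) =
      fun u : ℝ => halfLineDeriv φ (max (s u.toNNReal) 0) ^ α := by
    ext u
    rw [max_eq_left (hs.nonneg _)]
  have hmeas : Measurable fun u : ℝ => halfLineDeriv φ (s u.toNNReal) ^ α := by
    rw [heq]
    exact hcont.measurable.comp hmono.measurable
  obtain ⟨C, hC⟩ := (isCompact_Icc (a := 0) (b := s (max a b).toNNReal)).exists_bound_of_continuousOn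
    ((hφ.continuousOn_rpow_deriv α).mono Icc_subset_Ici_self)
  rw [intervalIntegrable_iff]
  refine Measure.integrableOn_of_bounded (M := C) measure_Ioc_lt_top.ne
    hmeas.aestronglyMeasurable ?_
  filter_upwards [ae_restrict_mem measurableSet_Ioc] with u hu
  exact hC _ ⟨hs.nonneg _, hmono hu.2⟩

/-- A family of additive functionals of intervals converges if on every interval it does so up to
an error controlled by the length of the interval and the increment of a monotone function. -/
lemma tendsto_of_interval_estimate {ι : Type*} {u : Filter ι} {A : ι → ℝ≥0 → ℝ} {I s : ℝ≥0 → ℝ}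
    {T : ℝ≥0} (hA : ∀ᶠ i in u, A i 0 = 0) (hI : I 0 = 0)
    (h : ∀ ε > 0, ∃ K, 0 ≤ K ∧ ∀ a b : ℝ≥0, a ≤ b → b ≤ T → ∀ δ > 0, ∀ᶠ i in u,
      |A i b - A i a - (I b - I a)| ≤ (b - a) * (ε + K * (s b - s a)) + δ) :
    Tendsto (fun i => A i T) u (𝓝 (I T)) := by
  rw [Metric.tendsto_nhds]
  intro η hη
  -- Three errors of at most η/4 are arranged: from ε, from the increments of `s`, and from the δ's.
  obtain ⟨K, hK0, hK⟩ := h (η / (4 * (T + 1))) (by positivity)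
  -- The increments of `s` telescope over the partition, so their total cost is the mesh T/(n+1)
  -- times K(s T − s 0). This is small for large `n`, even though `s` has jumps.
  obtain ⟨n, hn⟩ := exists_nat_gt (4 * T * K * |s T - s 0| / η)
  have hn1 : (0 : ℝ) < (n + 1 : ℕ) := by positivity
  set t : ℕ → ℝ≥0 := fun k => T * k / (n + 1 : ℕ) with ht
  have ht0 : t 0 = 0 := by simp [ht]
  have htn : t (n + 1) = T := by
    simp only [ht]
    exact mul_div_cancel_right₀ _ (by positivity)
  have htm : Monotone t := by
    intro i j hij
    simp only [ht]
    gcongr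
  have hlen : ∀ k, ((t (k + 1) : ℝ≥0) : ℝ) - t k = T / (n + 1 : ℕ) := by
    intro k
    simp only [ht]
    push_cast
    field_simp
    ring
  have hev : ∀ᶠ i in u, ∀ k ∈ Finset.range (n + 1),
      |A i (t (k + 1)) - A i (t k) - (I (t (k + 1)) - I (t k))| ≤
        (t (k + 1) - t k) * (η / (4 * (T + 1)) + K * (s (t (k + 1)) - s (t k))) +
          η / (4 * (n + 1 : ℕ)) := by
    rw [eventually_all_finset]
    intro k hk
    refine hK _ _ (htm k.le_succ) ?_ _ (by positivity)
    rw [← htn]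
    exact htm (Nat.succ_le_of_lt (Finset.mem_range.1 hk))
  filter_upwards [hA, hev] with i hi0 hi
  have h1 : A i T - I T = ∑ k ∈ Finset.range (n + 1),
      (A i (t (k + 1)) - A i (t k) - (I (t (k + 1)) - I (t k))) := by
    rw [Finset.sum_sub_distrib, Finset.sum_range_sub (fun k => A i (t k)),
      Finset.sum_range_sub (fun k => I (t k)), htn, ht0, hi0, hI]
    ring
  have h2 : |A i T - I T| ≤ ∑ k ∈ Finset.range (n + 1),
      ((T / (n + 1 : ℕ) : ℝ) * (η / (4 * (T + 1)) + K * (s (t (k + 1)) - s (t k))) +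
          η / (4 * (n + 1 : ℕ))) := by
    rw [h1]
    refine (Finset.abs_sum_le_sum_abs _ _).trans (Finset.sum_le_sum fun k hk => ?_)
    rw [← hlen k]
    exact hi k hk
  have h3 : ∑ k ∈ Finset.range (n + 1),
      ((T / (n + 1 : ℕ) : ℝ) * (η / (4 * (T + 1)) + K * (s (t (k + 1)) - s (t k))) +
          η / (4 * (n + 1 : ℕ))) =
      T * (η / (4 * (T + 1))) + T / (n + 1 : ℕ) * (K * (s T - s 0)) + η / 4 := by
    rw [Finset.sum_add_distrib, ← Finset.mul_sum, Finset.sum_add_distrib, ← Finset.mul_sum,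
      Finset.sum_range_sub (fun k => s (t k)), htn, ht0]
    simp only [Finset.sum_const, Finset.card_range, nsmul_eq_mul]
    field_simp
  have hT0 : (0 : ℝ) ≤ T := T.coe_nonneg
  have h4 : T * (η / (4 * (T + 1))) ≤ η / 4 := by
    rw [mul_div_assoc', div_le_div_iff₀ (by positivity) (by positivity)]
    nlinarith
  have h5 : (T / (n + 1 : ℕ) : ℝ) * (K * (s T - s 0)) ≤ η / 4 := by
    rw [div_mul_eq_mul_div, div_le_div_iff₀ hn1 (by positivity)]
    rw [div_lt_iff₀ hη] at hn
    have h6 : T * (K * (s T - s 0)) ≤ T * (K * |s T - s 0|) := by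
      gcongr
      exact le_abs_self _
    push_cast
    nlinarith
  rw [Real.dist_eq]
  linarith

/-- Convergence of the normalized jump counts of the transformed path follows from that of the
jump counts of the path itself. -/
lemma tendsto_gapCount_div {s : ℝ≥0 → ℝ} (hs : IsSubordinatorPath s) {φ : ℝ → ℝ}
    (hφ : IsHalfLineDiffeo φ) {α : ℝ} (hα : 0 < α) {l : ℝ → ℝ} (hl : SlowlyVarying l)
    (hN : ∀ t : ℝ≥0, Tendsto (fun x => ((jumpTimes s x t).ncard : ℝ) / scaling α l x) (𝓝[>] 0)
      (𝓝 t)) (T : ℝ≥0) :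
    Tendsto (fun x => (gapCount φ s x T : ℝ) / scaling α l x) (𝓝[>] 0)
      (𝓝 (gapLimit φ α s T)) := by
  -- Counting at level x/M while normalizing by ψ(x) costs the factor ψ(x/M)/ψ(x) → M^α.
  have hpiece : ∀ (a b : ℝ≥0) (M : ℝ), 0 < M → Tendsto (fun x =>
      (((jumpTimes s (M⁻¹ * x) b).ncard : ℝ) - (jumpTimes s (M⁻¹ * x) a).ncard) / scaling α l x)
      (𝓝[>] 0) (𝓝 ((b - a) * M ^ α)) := by
    intro a b M hM
    have h1 := (((hN b).sub (hN a)).comp (tendsto_const_mul_nhdsGT (inv_pos.2 hM))).mul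
      (hl.tendsto_scaling_div α (inv_pos.2 hM))
    rw [Real.inv_rpow hM.le, Real.rpow_neg hM.le, inv_inv] at h1
    refine h1.congr' ?_
    filter_upwards [(tendsto_const_mul_nhdsGT (inv_pos.2 hM)).eventually
      (hl.eventually_scaling_pos α)] with x hx
    simp only [Function.comp]
    rw [← sub_div, div_mul_div_cancel₀ hx.ne']
  have hint := fun a b => hs.intervalIntegrable hφ α a b
  refine tendsto_of_interval_estimate (A := fun x t => (gapCount φ s x t : ℝ) / scaling α l x)
    (I := fun t => gapLimit φ α s t) (s := s) ?_ (by simp [gapLimit]) ?_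
  · filter_upwards [self_mem_nhdsWithin] with x hx
    simp only [gapCount, jumpTimes_zero _ hx, ncard_empty, Nat.cast_zero, zero_div]
  · intro ε hε
    obtain ⟨K, hK0, hK⟩ := exists_abs_sub_le_add_mul (G := fun y => halfLineDeriv φ y ^ α)
      (R := s T) ((hφ.continuousOn_rpow_deriv α).mono Icc_subset_Ici_self) hε
    refine ⟨K, hK0, fun a b hab hbT δ hδ => ?_⟩
    have hsab : s a ≤ s b := hs.mono hab
    have hcont : ContinuousOn (halfLineDeriv φ) (Icc (s a) (s b)) :=
      hφ.continuousOn_deriv.mono fun y hy => (hs.nonneg a).trans hy.1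
    obtain ⟨y, hy, hymax⟩ := isCompact_Icc.exists_isMaxOn (nonempty_Icc.2 hsab) hcont
    obtain ⟨z, hz, hzmin⟩ := isCompact_Icc.exists_isMinOn (nonempty_Icc.2 hsab) hcont
    have hy0 := hφ.deriv_pos y ((hs.nonneg a).trans hy.1)
    have hz0 := hφ.deriv_pos z ((hs.nonneg a).trans hz.1)
    have hab' : (0 : ℝ) ≤ b - a := sub_nonneg.2 (by exact_mod_cast hab)
    -- The gap between the upper and lower bounds is the oscillation of φ'^α on [s a, s b], where
    -- the almost-Lipschitz estimate applies.
    have hyz : halfLineDeriv φ y ^ α - halfLineDeriv φ z ^ α ≤ ε + K * (s b - s a) := by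
      refine (le_abs_self _).trans ((hK y ⟨(hs.nonneg a).trans hy.1, hy.2.trans (hs.mono hbT)⟩ z
        ⟨(hs.nonneg a).trans hz.1, hz.2.trans (hs.mono hbT)⟩).trans ?_)
      gcongr
      rw [abs_le]
      constructor <;> linarith [hy.1, hy.2, hz.1, hz.2]
    have hI : gapLimit φ α s b - gapLimit φ α s a =
        ∫ u in (a : ℝ)..b, halfLineDeriv φ (s u.toNNReal) ^ α := by
      simp only [gapLimit, ENNReal.coe_toReal]
      rw [intervalIntegral.integral_interval_sub_left (hint _ _) (hint _ _)]
    have hmem : ∀ u ∈ Icc (a : ℝ) b, s u.toNNReal ∈ Icc (s a) (s b) := by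
      intro u hu
      refine ⟨hs.mono ?_, hs.mono ?_⟩
      · rw [← Real.toNNReal_coe (r := a)]
        exact Real.toNNReal_mono hu.1
      · rw [← Real.toNNReal_coe (r := b)]
        exact Real.toNNReal_mono hu.2
    have hIle : gapLimit φ α s b - gapLimit φ α s a ≤ (b - a) * halfLineDeriv φ y ^ α := by
      rw [hI]
      have := intervalIntegral.integral_mono_on (sub_nonneg.1 hab') (hint a b)
        (intervalIntegrable_const (c := halfLineDeriv φ y ^ α)) fun u hu =>
          Real.rpow_le_rpow (hφ.deriv_pos _ (hs.nonneg _)).le (hymax (hmem u hu)) hα.le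
      rwa [intervalIntegral.integral_const, smul_eq_mul] at this
    have hIge : (b - a) * halfLineDeriv φ z ^ α ≤ gapLimit φ α s b - gapLimit φ α s a := by
      rw [hI]
      have := intervalIntegral.integral_mono_on (sub_nonneg.1 hab')
        (intervalIntegrable_const (c := halfLineDeriv φ z ^ α)) (hint a b) fun u hu =>
          Real.rpow_le_rpow hz0.le (hzmin (hmem u hu)) hα.le
      rwa [intervalIntegral.integral_const, smul_eq_mul] at this
    filter_upwards [self_mem_nhdsWithin, hl.eventually_scaling_pos α,
      (hpiece a b _ hy0).eventually_lt_const (lt_add_of_pos_right _ hδ),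
      (hpiece a b _ hz0).eventually_const_lt (sub_lt_self _ hδ)] with x hx hψ hup hlo
    have h1 := div_le_div_of_nonneg_right (jumpTimes_comp_sub_le hs hφ hx hab hy0 hymax) hψ.le
    have h2 := div_le_div_of_nonneg_right (le_jumpTimes_comp_sub hs hφ hx hab hz0 hzmin) hψ.le
    simp only [gapCount]
    rw [← sub_div]
    have h3 := mul_le_mul_of_nonneg_left hyz hab'
    rw [abs_le]
    constructor <;> linarith

/-! ### The tail of the Lévy measure as a limit of rates of small-time increments. -/

section Moments

lemma integrable_of_continuous_of_measure_compl_Icc {ρ : Measure ℝ} [IsFiniteMeasure ρ]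
    (hρ : ρ (Icc 0 1)ᶜ = 0) {g : ℝ → ℝ} (hg : Continuous g) : Integrable g ρ := by
  obtain ⟨C, hC⟩ := (isCompact_Icc (a := (0 : ℝ)) (b := 1)).exists_bound_of_continuousOn
    hg.continuousOn
  refine Integrable.of_bound hg.aestronglyMeasurable C ?_
  have : ∀ᵐ x ∂ρ, x ∈ Icc (0 : ℝ) 1 := hρ
  filter_upwards [this] with x hx using hC x hx

/-- For finite measures on `[0, 1]`, convergence of moments implies convergence of the integrals of
continuous functions. -/
lemma tendsto_integral_of_tendsto_moments {ρ : ℕ → Measure ℝ} {ρ' : Measure ℝ}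
    [∀ n, IsFiniteMeasure (ρ n)] [IsFiniteMeasure ρ'] (hρ : ∀ n, ρ n (Icc 0 1)ᶜ = 0)
    (hρ' : ρ' (Icc 0 1)ᶜ = 0)
    (hmom : ∀ k : ℕ, Tendsto (fun n => ∫ z, z ^ k ∂(ρ n)) atTop (𝓝 (∫ z, z ^ k ∂ρ')))
    {g : ℝ → ℝ} (hg : Continuous g) :
    Tendsto (fun n => ∫ z, g z ∂(ρ n)) atTop (𝓝 (∫ z, g z ∂ρ')) := by
  have hpoly : ∀ p : Polynomial ℝ,
      Tendsto (fun n => ∫ z, p.eval z ∂(ρ n)) atTop (𝓝 (∫ z, p.eval z ∂ρ')) := by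
    intro p
    have aux : ∀ (σ : Measure ℝ) [IsFiniteMeasure σ], σ (Icc 0 1)ᶜ = 0 → ∫ z, p.eval z ∂σ =
        ∑ k ∈ Finset.range (p.natDegree + 1), p.coeff k * ∫ z, z ^ k ∂σ := by
      intro σ _ hσ
      simp_rw [Polynomial.eval_eq_sum_range]
      rw [integral_finsetSum _ fun k _ =>
        (integrable_of_continuous_of_measure_compl_Icc hσ (continuous_pow k)).const_mul _]
      simp_rw [integral_const_mul]
    simp_rw [aux _ (hρ _), aux _ hρ']
    exact tendsto_finsetSum _ fun k _ => (hmom k).const_mul _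
  have hmass : ∀ (σ : Measure ℝ), ∫ z, z ^ 0 ∂σ = σ.real univ := fun σ => by simp
  rw [Metric.tendsto_atTop]
  intro η hη
  -- The total mass is the zeroth moment, so the masses are eventually below this constant and one
  -- polynomial serves all measures at once.
  set C := ρ'.real univ + 1 with hC
  have hC0 : 0 < C := by positivity
  have hCn : ∀ᶠ n in atTop, (ρ n).real univ < C := by
    have := hmom 0
    simp_rw [hmass] at this
    exact this.eventually_lt_const (lt_add_one _)
  obtain ⟨p, hp⟩ := exists_polynomial_near_of_continuousOn 0 1 g hg.continuousOn (η / (4 * C))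
    (by positivity)
  have happrox : ∀ (σ : Measure ℝ) [IsFiniteMeasure σ], σ (Icc 0 1)ᶜ = 0 → σ.real univ ≤ C →
      |∫ z, g z ∂σ - ∫ z, p.eval z ∂σ| ≤ η / 4 := by
    intro σ _ hσ hσC
    rw [← integral_sub (integrable_of_continuous_of_measure_compl_Icc hσ hg)
      (integrable_of_continuous_of_measure_compl_Icc hσ p.continuous)]
    have h1 : ‖∫ z, (g z - p.eval z) ∂σ‖ ≤ η / (4 * C) * σ.real univ := by
      refine norm_integral_le_of_norm_le_const ?_
      have : ∀ᵐ x ∂σ, x ∈ Icc (0 : ℝ) 1 := hσ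
      filter_upwards [this] with z hz
      rw [Real.norm_eq_abs, abs_sub_comm]
      exact (hp z hz).le
    rw [Real.norm_eq_abs] at h1
    refine h1.trans ?_
    calc η / (4 * C) * σ.real univ ≤ η / (4 * C) * C := by gcongr
      _ = η / 4 := by field_simp
  rw [← eventually_atTop]
  filter_upwards [hCn, Metric.tendsto_nhds.1 (hpoly p) (η / 4) (by positivity)] with n hn hpn
  have h1 := abs_le.1 (happrox (ρ n) (hρ n) hn.le)
  have h2 := abs_le.1 (happrox ρ' hρ' (by linarith))
  rw [Real.dist_eq] at hpn ⊢
  have h3 := abs_lt.1 hpn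
  rw [abs_lt]
  constructor <;> linarith [h1.1, h1.2, h2.1, h2.2, h3.1, h3.2]

/-- The image under `e` of `c (1 - e) μ`. -/
noncomputable def weightedMap {X : Type*} [MeasurableSpace X] (μ : Measure X) (e : X → ℝ) (c : ℝ) :
    Measure ℝ :=
  (μ.withDensity fun x => ENNReal.ofReal (c * (1 - e x))).map e

variable {X : Type*} [MeasurableSpace X] {μ : Measure X} {e : X → ℝ} {c : ℝ}

lemma integral_weightedMap (he : Measurable e) (h1 : ∀ᵐ x ∂μ, e x ∈ Icc (0 : ℝ) 1) (hc : 0 ≤ c)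
    {g : ℝ → ℝ} (hg : Continuous g) :
    ∫ z, g z ∂(weightedMap μ e c) = c * ∫ x, g (e x) * (1 - e x) ∂μ := by
  rw [weightedMap, integral_map he.aemeasurable hg.aestronglyMeasurable,
    integral_withDensity_eq_integral_toReal_smul (by fun_prop) (by simp), ← integral_const_mul]
  refine integral_congr_ae ?_
  filter_upwards [h1] with x hx
  rw [ENNReal.toReal_ofReal (mul_nonneg hc (sub_nonneg.2 hx.2)), smul_eq_mul]
  ring

lemma isFiniteMeasure_weightedMap (hi : Integrable (fun x => 1 - e x) μ) :
    IsFiniteMeasure (weightedMap μ e c) := by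
  have := isFiniteMeasure_withDensity_ofReal (hi.const_mul c).2
  rw [weightedMap]
  infer_instance

lemma weightedMap_compl_Icc (he : Measurable e) (h1 : ∀ᵐ x ∂μ, e x ∈ Icc (0 : ℝ) 1) :
    weightedMap μ e c (Icc 0 1)ᶜ = 0 := by
  rw [weightedMap, Measure.map_apply he measurableSet_Icc.compl]
  exact withDensity_absolutelyContinuous _ _ h1

end Moments

lemma IsSubordinatorLevyMeasure.ae_pos {ν : Measure ℝ} (hν : IsSubordinatorLevyMeasure ν) :
    ∀ᵐ y ∂ν, 0 < y := by
  rw [ae_iff]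
  convert! hν.nonpos_null using 2
  ext y
  simp

lemma IsSubordinatorLevyMeasure.measure_Ici_lt_top {ν : Measure ℝ}
    (hν : IsSubordinatorLevyMeasure ν) {x : ℝ} (hx : 0 < x) : ν (Ici x) < ∞ := by
  have h0 : ENNReal.ofReal (min 1 x) ≠ 0 := by simp [hx]
  have h1 := mul_meas_ge_le_lintegral₀ (μ := ν) (f := fun y => ENNReal.ofReal (min 1 y))
    (by fun_prop) (ENNReal.ofReal (min 1 x))
  have h2 : ν (Ici x) ≤ ν {y | ENNReal.ofReal (min 1 x) ≤ ENNReal.ofReal (min 1 y)} :=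
    measure_mono fun y hy => ENNReal.ofReal_le_ofReal (min_le_min_left _ hy)
  by_contra hcon
  rw [not_lt, top_le_iff] at hcon
  rw [hcon, top_le_iff] at h2
  rw [h2, ENNReal.mul_top h0, top_le_iff] at h1
  exact hν.lintegral_lt_top.ne h1

lemma IsSubordinatorLevyMeasure.integrable_one_sub_exp {ν : Measure ℝ}
    (hν : IsSubordinatorLevyMeasure ν) {q : ℝ} (hq : 0 ≤ q) :
    Integrable (fun y => 1 - Real.exp (-(q * y))) ν := by
  have h0 : Integrable (fun y => min 1 y) ν := by
    refine ⟨by fun_prop, ?_⟩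
    rw [hasFiniteIntegral_iff_ofReal]
    · exact hν.lintegral_lt_top
    · filter_upwards [hν.ae_pos] with y hy
      exact le_min zero_le_one hy.le
  refine (h0.const_mul (1 + q)).mono' (by fun_prop) ?_
  filter_upwards [hν.ae_pos] with y hy
  have hqy : 0 ≤ q * y := mul_nonneg hq hy.le
  have h1 : Real.exp (-(q * y)) ≤ 1 := Real.exp_le_one_iff.2 (by linarith)
  have h2 := Real.add_one_le_exp (-(q * y))
  have h3 := Real.exp_pos (-(q * y))
  rw [Real.norm_eq_abs, abs_of_nonneg (by linarith)]
  rcases min_cases 1 y with ⟨h, _⟩ | ⟨h, _⟩ <;> rw [h] <;> nlinarith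

/-- These are the moments of the image of (1 − e^{-y})ν(dy) under y ↦ e^{-y}. The weight makes this
measure finite although ν may have infinite mass near 0. -/
lemma IsSubordinatorLevyMeasure.integral_exp_pow {ν : Measure ℝ}
    (hν : IsSubordinatorLevyMeasure ν) (k : ℕ) :
    ∫ y, Real.exp (-y) ^ k * (1 - Real.exp (-y)) ∂ν =
      laplaceExponent ν (k + 1 : ℕ) - laplaceExponent ν k := by
  rw [laplaceExponent, laplaceExponent, ← integral_sub (hν.integrable_one_sub_exp (by positivity))
    (hν.integrable_one_sub_exp (by positivity))]
  refine integral_congr_ae (Eventually.of_forall fun y => ?_)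
  simp only
  rw [← mul_neg, ← mul_neg, Real.exp_nat_mul, Real.exp_nat_mul, pow_succ]
  ring

/-- A continuous function on `ℝ` whose product with `1 - z` decreases from `1` on `(-∞, B]` to `0`
on `[A, ∞)`. -/
noncomputable def rampQuot (A B z : ℝ) : ℝ :=
  min 1 (max 0 ((A - z) / (A - B))) / max (1 - z) (1 - A)

lemma continuous_rampQuot {A B : ℝ} (hA : A < 1) : Continuous (rampQuot A B) := by
  unfold rampQuot
  refine Continuous.div (by fun_prop) (by fun_prop) fun z => ?_
  exact (lt_max_of_lt_right (sub_pos.2 hA)).ne'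

lemma rampQuot_mul {A B : ℝ} (hBA : B < A) (hA : A < 1) (z : ℝ) :
    rampQuot A B z * (1 - z) = min 1 (max 0 ((A - z) / (A - B))) := by
  rw [rampQuot]
  -- The denominator differs from `1 - z` only for z > A, where the numerator vanishes.
  rcases le_total z A with h | h
  · rw [max_eq_left (a := 1 - z) (by linarith), div_mul_cancel₀ _ (by linarith)]
  · rw [max_eq_left (a := 0) (div_nonpos_of_nonpos_of_nonneg (by linarith) (by linarith))]
    simp

lemma rampQuot_mul_eq_one {A B z : ℝ} (hBA : B < A) (hA : A < 1) (hz : z ≤ B) :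
    rampQuot A B z * (1 - z) = 1 := by
  rw [rampQuot_mul hBA hA, min_eq_left]
  refine le_max_of_le_right ?_
  rw [le_div_iff₀ (by linarith)]
  linarith

lemma rampQuot_mul_eq_zero {A B z : ℝ} (hBA : B < A) (hA : A < 1) (hz : A ≤ z) :
    rampQuot A B z * (1 - z) = 0 := by
  rw [rampQuot_mul hBA hA, max_eq_left (div_nonpos_of_nonpos_of_nonneg (by linarith) (by linarith))]
  simp

lemma rampQuot_mul_mem {A B : ℝ} (hBA : B < A) (hA : A < 1) (z : ℝ) :
    rampQuot A B z * (1 - z) ∈ Icc (0 : ℝ) 1 := by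
  rw [rampQuot_mul hBA hA]
  exact ⟨le_min zero_le_one (le_max_left _ _), min_le_left _ _⟩

/-- The integral of a ramp function lies between the measures of two upper level sets. -/
lemma integral_ramp_mem {X : Type*} [MeasurableSpace X] {μ : Measure X} {f : X → ℝ}
    (hf : Measurable f) {a b : ℝ} (ha : 0 < a) (hab : a < b) (hfin : μ (f ⁻¹' Ici a) < ∞) :
    ∫ x, rampQuot (Real.exp (-a)) (Real.exp (-b)) (Real.exp (-f x)) * (1 - Real.exp (-f x)) ∂μ ∈
      Icc (μ.real (f ⁻¹' Ici b)) (μ.real (f ⁻¹' Ici a)) := by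
  have hBA : Real.exp (-b) < Real.exp (-a) := Real.exp_lt_exp.2 (by linarith)
  have hA : Real.exp (-a) < 1 := Real.exp_lt_one_iff.2 (by linarith)
  have hma : MeasurableSet (f ⁻¹' Ici a) := hf measurableSet_Ici
  have hmb : MeasurableSet (f ⁻¹' Ici b) := hf measurableSet_Ici
  have hle : ∀ x, rampQuot (Real.exp (-a)) (Real.exp (-b)) (Real.exp (-f x)) *
      (1 - Real.exp (-f x)) ≤ (f ⁻¹' Ici a).indicator 1 x := by
    intro x
    by_cases h : x ∈ f ⁻¹' Ici a
    · rw [indicator_of_mem h]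
      exact (rampQuot_mul_mem hBA hA _).2
    · rw [indicator_of_notMem h]
      have h' : f x < a := not_le.1 h
      exact (rampQuot_mul_eq_zero hBA hA (Real.exp_le_exp.2 (by linarith))).le
  have hge : ∀ x, (f ⁻¹' Ici b).indicator 1 x ≤ rampQuot (Real.exp (-a)) (Real.exp (-b))
      (Real.exp (-f x)) * (1 - Real.exp (-f x)) := by
    intro x
    by_cases h : x ∈ f ⁻¹' Ici b
    · rw [indicator_of_mem h]
      have h' : b ≤ f x := h
      exact (rampQuot_mul_eq_one hBA hA (Real.exp_le_exp.2 (by linarith))).ge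
    · rw [indicator_of_notMem h]
      exact (rampQuot_mul_mem hBA hA _).1
  have hia : Integrable ((f ⁻¹' Ici a).indicator (1 : X → ℝ)) μ :=
    (integrable_indicator_iff hma).2 (integrableOn_const hfin.ne)
  have hib : Integrable ((f ⁻¹' Ici b).indicator (1 : X → ℝ)) μ :=
    (integrable_indicator_iff hmb).2 (integrableOn_const
      ((measure_mono (preimage_mono (Ici_subset_Ici.2 hab.le))).trans_lt hfin).ne)
  have hir : Integrable (fun x => rampQuot (Real.exp (-a)) (Real.exp (-b)) (Real.exp (-f x)) *
      (1 - Real.exp (-f x))) μ := by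
    have hcont : Continuous fun y : ℝ => rampQuot (Real.exp (-a)) (Real.exp (-b)) (Real.exp (-y)) *
        (1 - Real.exp (-y)) :=
      ((continuous_rampQuot hA).comp (by fun_prop)).mul (by fun_prop)
    refine hia.mono' (hcont.measurable.comp hf).aestronglyMeasurable
      (Eventually.of_forall fun x => ?_)
    rw [Real.norm_eq_abs, abs_of_nonneg (rampQuot_mul_mem hBA hA _).1]
    exact hle x
  have h1 := integral_mono hib hir hge
  have h2 := integral_mono hir hia hle
  rw [integral_indicator_one hmb] at h1
  rw [integral_indicator_one hma] at h2
  exact ⟨h1, h2⟩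

namespace IsDriftlessSubordinator

variable {Ω : Type*} [MeasurableSpace Ω] {P : Measure Ω} {S : ℝ≥0 → Ω → ℝ} {ν : Measure ℝ}

lemma ae_isSubordinatorPath (hS : IsDriftlessSubordinator S ν P) :
    ∀ᵐ ω ∂P, IsSubordinatorPath (S · ω) := by
  filter_upwards [hS.mono, hS.rightCont, hS.start_zero] with ω h1 h2 h3 using ⟨h1, h2, h3⟩

variable [IsProbabilityMeasure P]

lemma integral_exp_pow (hS : IsDriftlessSubordinator S ν P) (t : ℝ≥0) (k : ℕ) :
    ∫ ω, Real.exp (-S t ω) ^ k * (1 - Real.exp (-S t ω)) ∂P =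
      Real.exp (-(t * laplaceExponent ν k)) - Real.exp (-(t * laplaceExponent ν (k + 1 : ℕ))) := by
  rw [← hS.laplace t k (by positivity), ← hS.laplace t (k + 1 : ℕ) (by positivity)]
  have hint : ∀ k : ℕ, Integrable (fun ω => Real.exp (-(k * S t ω))) P := by
    intro k
    have := hS.measurable t
    refine Integrable.of_bound (by fun_prop) 1 ?_
    filter_upwards [hS.ae_isSubordinatorPath] with ω hω
    rw [Real.norm_eq_abs, Real.abs_exp, Real.exp_le_one_iff]
    have := mul_nonneg (Nat.cast_nonneg k) (hω.nonneg t)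
    linarith
  rw [← integral_sub (hint k) (hint (k + 1))]
  refine integral_congr_ae (Eventually.of_forall fun y => ?_)
  simp only
  rw [← mul_neg, ← mul_neg, Real.exp_nat_mul, Real.exp_nat_mul, pow_succ]
  ring

/-- A difference quotient at 0 of h ↦ e^{-hA} − e^{-hB}, along h = 2^{-n}. With Laplace exponents
for `A` and `B`, it is the convergence of moments. -/
lemma tendsto_two_pow_mul_exp_sub (A B : ℝ) :
    Tendsto (fun n : ℕ => (2 : ℝ) ^ n * (Real.exp (-((((2 : ℝ≥0) ^ n)⁻¹ : ℝ≥0) * A)) -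
      Real.exp (-((((2 : ℝ≥0) ^ n)⁻¹ : ℝ≥0) * B)))) atTop (𝓝 (B - A)) := by
  have hd : ∀ A : ℝ, HasDerivAt (fun h : ℝ => Real.exp (-(h * A))) (-A) 0 := by
    intro A
    have := ((hasDerivAt_mul_const (x := (0 : ℝ)) A).neg).exp
    simpa using this
  have h1 := hasDerivAt_iff_tendsto_slope_zero.1 ((hd A).sub (hd B))
  have h2 : Tendsto (fun n : ℕ => ((2 : ℝ) ^ n)⁻¹) atTop (𝓝[≠] 0) := by
    refine tendsto_nhdsWithin_iff.2 ⟨?_, Eventually.of_forall fun n => by simp⟩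
    exact (tendsto_inv_atTop_zero.comp (tendsto_pow_atTop_atTop_of_one_lt one_lt_two))
  have h3 := h1.comp h2
  rw [neg_sub_neg] at h3
  refine h3.congr fun n => ?_
  simp

/-- The rates `2 ^ n P(S_{2 ^ -n} ≥ x)` are squeezed, up to a convergent sequence, by the tails of
the Lévy measure. -/
lemma exists_tendsto_between (hS : IsDriftlessSubordinator S ν P) {a b : ℝ} (ha : 0 < a)
    (hab : a < b) : ∃ (R : ℕ → ℝ) (R' : ℝ), Tendsto R atTop (𝓝 R') ∧
      R' ∈ Icc (ν.real (Ici b)) (ν.real (Ici a)) ∧ ∀ n,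
        R n ∈ Icc (2 ^ n * P.real {ω | b ≤ S (2 ^ n)⁻¹ ω})
          (2 ^ n * P.real {ω | a ≤ S (2 ^ n)⁻¹ ω}) := by
  have hA : Real.exp (-a) < 1 := Real.exp_lt_one_iff.2 (by linarith)
  set g := rampQuot (Real.exp (-a)) (Real.exp (-b)) with hg
  have hgc : Continuous g := continuous_rampQuot hA
  have hm : ∀ t, Measurable fun ω => Real.exp (-S t ω) := fun t =>
    Real.measurable_exp.comp (hS.measurable t).neg
  have hm' : Measurable fun y : ℝ => Real.exp (-y) := by fun_prop
  have hP : ∀ t, ∀ᵐ ω ∂P, Real.exp (-S t ω) ∈ Icc (0 : ℝ) 1 := by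
    intro t
    filter_upwards [hS.ae_isSubordinatorPath] with ω hω
    exact ⟨(Real.exp_pos _).le, Real.exp_le_one_iff.2 (by linarith [hω.nonneg t])⟩
  have hν : ∀ᵐ y ∂ν, Real.exp (-y) ∈ Icc (0 : ℝ) 1 := by
    filter_upwards [hS.levyMeasure.ae_pos] with y hy
    exact ⟨(Real.exp_pos _).le, Real.exp_le_one_iff.2 (by linarith)⟩
  have hfP : ∀ (t : ℝ≥0) (c : ℝ), IsFiniteMeasure (weightedMap P (fun ω => Real.exp (-S t ω)) c) := by
    intro t c
    refine isFiniteMeasure_weightedMap (Integrable.of_bound ?_ 1 ?_)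
    · exact ((hm t).const_sub 1).aestronglyMeasurable
    · filter_upwards [hP t] with ω hω
      rw [Real.norm_eq_abs, abs_le]
      constructor <;> linarith [hω.1, hω.2]
  have hfν : IsFiniteMeasure (weightedMap ν (fun y => Real.exp (-y)) 1) := by
    refine isFiniteMeasure_weightedMap ?_
    simpa using hS.levyMeasure.integrable_one_sub_exp zero_le_one
  -- The ramp is divided by `1 - z` to form `g`, so integrating `g` against the weighted images
  -- restores the ramp itself.
  have key := tendsto_integral_of_tendsto_moments
    (ρ := fun n => weightedMap P (fun ω => Real.exp (-S (2 ^ n)⁻¹ ω)) (2 ^ n))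
    (ρ' := weightedMap ν (fun y => Real.exp (-y)) 1)
    (fun n => weightedMap_compl_Icc (hm _) (hP _)) (weightedMap_compl_Icc hm' hν) (fun k => ?_) hgc
  · refine ⟨_, _, key, ?_, fun n => ?_⟩
    · rw [integral_weightedMap hm' hν zero_le_one hgc, one_mul]
      exact integral_ramp_mem measurable_id ha hab (hS.levyMeasure.measure_Ici_lt_top ha)
    · rw [integral_weightedMap (hm _) (hP _) (by positivity) hgc]
      have := integral_ramp_mem (μ := P) (hS.measurable (2 ^ n)⁻¹) ha hab (measure_lt_top _ _)
      exact ⟨mul_le_mul_of_nonneg_left this.1 (by positivity),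
        mul_le_mul_of_nonneg_left this.2 (by positivity)⟩
  · simp_rw [integral_weightedMap (hm _) (hP _) (pow_nonneg zero_le_two _) (continuous_pow k)]
    rw [integral_weightedMap hm' hν zero_le_one (continuous_pow k), one_mul,
      hS.levyMeasure.integral_exp_pow]
    simp_rw [hS.integral_exp_pow]
    exact tendsto_two_pow_mul_exp_sub _ _

/-- The upper bound holds at every level, because y ↦ ν[y,∞) is left-continuous: a level a < x
slightly below costs little. Only the matching lower bound needs a continuity point. -/
lemma eventually_two_pow_mul_le (hS : IsDriftlessSubordinator S ν P) {x r : ℝ} (hx : 0 < x)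
    (hr : ν.real (Ici x) < r) :
    ∀ᶠ n : ℕ in atTop, 2 ^ n * P.real {ω | x ≤ S (2 ^ n)⁻¹ ω} ≤ r := by
  have hfin := fun {a : ℝ} (ha : 0 < a) => (hS.levyMeasure.measure_Ici_lt_top ha).ne
  obtain ⟨a, ha0, hax, har⟩ : ∃ a, 0 < a ∧ a < x ∧ ν.real (Ici a) < r := by
    have hpos : ∀ j : ℕ, 0 < x / (j + 2) := fun j => by positivity
    have hlt : ∀ j : ℕ, x / (j + 2) < x := fun j => by
      rw [div_lt_iff₀ (by positivity)]
      nlinarith [(Nat.cast_nonneg j : (0 : ℝ) ≤ j)]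
    have hanti : Antitone fun j : ℕ => Ici (x - x / (j + 2)) := by
      intro i j hij
      refine Ici_subset_Ici.2 ?_
      gcongr
    have h1 := tendsto_measure_iInter_atTop (μ := ν) (s := fun j : ℕ => Ici (x - x / (j + 2)))
      (fun j => measurableSet_Ici.nullMeasurableSet) hanti
      ⟨0, hfin (sub_pos.2 (hlt 0))⟩
    have h2 : ⋂ j : ℕ, Ici (x - x / (j + 2)) = Ici x := by
      ext y
      simp only [mem_iInter, mem_Ici]
      refine ⟨fun h => ?_, fun h j => by linarith [hpos j]⟩
      have h3 : Tendsto (fun j : ℕ => x - x / (j + 2)) atTop (𝓝 (x - 0)) := by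
        refine tendsto_const_nhds.sub (tendsto_const_nhds.div_atTop ?_)
        exact tendsto_atTop_add_const_right _ _ tendsto_natCast_atTop_atTop
      rw [sub_zero] at h3
      exact le_of_tendsto' h3 h
    rw [h2] at h1
    have h3 := (ENNReal.tendsto_toReal (hfin hx)).comp h1
    obtain ⟨j, hj⟩ := (h3.eventually_lt_const hr).exists
    exact ⟨_, sub_pos.2 (hlt j), by linarith [hpos j], hj⟩
  obtain ⟨R, R', hR, hR', hRn⟩ := hS.exists_tendsto_between ha0 hax
  filter_upwards [hR.eventually_lt_const (hR'.2.trans_lt har)] with n hn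
  exact (hRn n).1.trans hn.le

lemma tendsto_two_pow_mul (hS : IsDriftlessSubordinator S ν P) {x : ℝ} (hx : 0 < x)
    (hc : ContinuousAt (fun y => ν (Ici y)) x) :
    Tendsto (fun n : ℕ => 2 ^ n * P.real {ω | x ≤ S (2 ^ n)⁻¹ ω}) atTop (𝓝 (ν.real (Ici x))) := by
  have hfin := (hS.levyMeasure.measure_Ici_lt_top hx).ne
  refine tendsto_order.2 ⟨fun r hr => ?_, fun r hr => ?_⟩
  · have h1 := (ENNReal.tendsto_toReal hfin).comp hc
    have h2 : Tendsto (fun y => ν.real (Ici y)) (𝓝[>] x) (𝓝 (ν.real (Ici x))) :=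
      h1.mono_left nhdsWithin_le_nhds
    obtain ⟨b, hb, hxb⟩ := ((h2.eventually_const_lt hr).and self_mem_nhdsWithin).exists
    obtain ⟨R, R', hR, hR', hRn⟩ := hS.exists_tendsto_between hx hxb
    filter_upwards [hR.eventually_const_lt (hb.trans_le hR'.1)] with n hn
    exact hn.trans_le (hRn n).2
  · obtain ⟨r', h1, h2⟩ := exists_between hr
    filter_upwards [hS.eventually_two_pow_mul_le hx h1] with n hn
    exact hn.trans_lt h2

end IsDriftlessSubordinator

/-! ### Measurability and expectation of the counts. -/

lemma toReal_encard {X : Type*} (s : Set X) : (s.encard : ℝ≥0∞).toReal = s.ncard := by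
  by_cases hs : s.Finite
  · rw [← hs.cast_ncard_eq]
    simp
  · have hs' : s.Infinite := hs
    rw [hs'.encard_eq, hs'.ncard]
    simp

lemma encard_eq_tsum_indicator {X : Type*} (s : Set X) :
    (s.encard : ℝ≥0∞) = ∑' k, s.indicator (fun _ => (1 : ℝ≥0∞)) k := by
  rw [← ENNReal.tsum_set_one, tsum_subtype s fun _ => (1 : ℝ≥0∞)]

lemma encard_dyadicPt_le (n : ℕ) (T : ℝ≥0∞) :
    ({k | (dyadicPt n k : ℝ≥0∞) ≤ T}.encard : ℝ≥0∞) ≤ 2 ^ n * T + 1 := by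
  rcases eq_or_ne T ∞ with rfl | hT
  · rw [ENNReal.mul_top (by positivity), top_add]
    exact le_top
  · lift T to ℝ≥0 using hT
    have hsub : {k | (dyadicPt n k : ℝ≥0∞) ≤ T} ⊆ (Finset.range (⌊T * 2 ^ n⌋₊ + 1) : Set ℕ) := by
      intro k hk
      have hk' : dyadicPt n k ≤ T := by exact_mod_cast (hk : (dyadicPt n k : ℝ≥0∞) ≤ T)
      rw [dyadicPt, div_le_iff₀ (by positivity)] at hk'
      simpa using Nat.lt_succ_of_le (Nat.le_floor hk')
    have h1 : ({k | (dyadicPt n k : ℝ≥0∞) ≤ T}.encard : ℝ≥0∞) ≤ ((⌊T * 2 ^ n⌋₊ + 1 : ℕ) : ℝ≥0∞) := by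
      have := encard_le_encard hsub
      rw [encard_coe_eq_coe_finsetCard, Finset.card_range] at this
      calc _ ≤ (((⌊T * 2 ^ n⌋₊ + 1 : ℕ) : ℕ∞) : ℝ≥0∞) := ENat.toENNReal_le.2 this
        _ = _ := by simp
    refine h1.trans ?_
    have h2 : ((⌊T * 2 ^ n⌋₊ : ℕ) : ℝ≥0) ≤ T * 2 ^ n := Nat.floor_le zero_le
    have h3 : ((⌊T * 2 ^ n⌋₊ + 1 : ℕ) : ℝ≥0) ≤ 2 ^ n * T + 1 := by
      push_cast
      rw [mul_comm (2 ^ n) T]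
      gcongr
    exact_mod_cast h3

section Measurability

variable {Ω : Type*} [MeasurableSpace Ω]

lemma measurable_encard_setOf {A : ℕ → Set Ω} (hA : ∀ k, MeasurableSet (A k)) :
    Measurable fun ω => ({k | ω ∈ A k}.encard : ℝ≥0∞) := by
  simp_rw [encard_eq_tsum_indicator]
  refine Measurable.tsum fun k => ?_
  exact (measurable_const (a := (1 : ℝ≥0∞))).indicator (hA k)

lemma lintegral_encard_setOf {P : Measure Ω} {A : ℕ → Set Ω} (hA : ∀ k, MeasurableSet (A k)) :
    ∫⁻ ω, ({k | ω ∈ A k}.encard : ℝ≥0∞) ∂P = ∑' k, P (A k) := by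
  simp_rw [encard_eq_tsum_indicator]
  rw [lintegral_tsum]
  · refine tsum_congr fun k => ?_
    exact lintegral_indicator_one (hA k)
  · exact fun k => ((measurable_const (a := (1 : ℝ≥0∞))).indicator (hA k)).aemeasurable

variable {f : ℝ≥0 → Ω → ℝ} {τ : Ω → ℝ≥0∞}

lemma measurableSet_gridJump (hf : ∀ t, Measurable (f t)) (hτ : Measurable τ) (x : ℝ) (n k : ℕ) :
    MeasurableSet {ω | (dyadicPt n k : ℝ≥0∞) ≤ τ ω ∧
      x ≤ f (dyadicPt n (k + 1)) ω - f (dyadicPt n k) ω} :=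
  (measurableSet_le measurable_const hτ).inter
    (measurableSet_le measurable_const ((hf _).sub (hf _)))

lemma measurable_encard_gridJumps (hf : ∀ t, Measurable (f t)) (hτ : Measurable τ) (x : ℝ)
    (n : ℕ) : Measurable fun ω => ((gridJumps (f · ω) x (τ ω) n).encard : ℝ≥0∞) :=
  measurable_encard_setOf (measurableSet_gridJump hf hτ x n)

lemma tendsto_encard_gridJumps {s : ℝ≥0 → ℝ} (hs : Monotone s)
    (hr : ∀ t, ContinuousWithinAt s (Ici t) t) {x : ℝ} (hx : 0 < x) {T : ℝ≥0∞} (hT : T ≠ ∞) :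
    Tendsto (fun n => ((gridJumps s x T n).encard : ℝ≥0∞)) atTop
      (𝓝 ((jumpTimes s x T).encard : ℝ≥0∞)) := by
  lift T to ℝ≥0 using hT
  refine tendsto_const_nhds.congr' ?_
  filter_upwards [eventually_encard_gridJumps hs hr hx T] with n hn
  rw [hn]

lemma aemeasurable_encard_jumpTimes {P : Measure Ω} (hf : ∀ t, Measurable (f t))
    (hmono : ∀ᵐ ω ∂P, Monotone (f · ω))
    (hr : ∀ᵐ ω ∂P, ∀ t, ContinuousWithinAt (f · ω) (Ici t) t) (hτ : Measurable τ)
    (hτ' : ∀ᵐ ω ∂P, τ ω ≠ ∞) {x : ℝ} (hx : 0 < x) :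
    AEMeasurable (fun ω => ((jumpTimes (f · ω) x (τ ω)).encard : ℝ≥0∞)) P := by
  refine aemeasurable_of_tendsto_metrizable_ae'
    (fun n => (measurable_encard_gridJumps hf hτ x n).aemeasurable) ?_
  filter_upwards [hmono, hr, hτ'] with ω h1 h2 h3 using tendsto_encard_gridJumps h1 h2 hx h3

end Measurability

/-! ### Stopping times, independence of the past, and the Wald bound. -/

lemma IsTruncStoppingTime.measurable {Ω : Type*} [mΩ : MeasurableSpace Ω] {F : Filtration ℝ≥0 mΩ}
    {τ : Ω → ℝ≥0∞} (hτ : IsTruncStoppingTime F τ) : Measurable τ := by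
  have h : ∀ n : ℕ, Measurable fun ω => min (τ ω) ((n : ℝ≥0) : ℝ≥0∞) :=
    fun n => (hτ n).mono (F.le _) le_rfl
  refine measurable_of_tendsto_metrizable h (tendsto_pi_nhds.2 fun ω => ?_)
  have : Tendsto (fun n : ℕ => min (τ ω) ((n : ℝ≥0) : ℝ≥0∞)) atTop (𝓝 (min (τ ω) ∞)) := by
    simpa using tendsto_const_nhds.min ENNReal.tendsto_nat_nhds_top
  rwa [min_eq_left le_top] at this

lemma IsTruncStoppingTime.measurableSet_ge {Ω : Type*} [mΩ : MeasurableSpace Ω]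
    {F : Filtration ℝ≥0 mΩ} {τ : Ω → ℝ≥0∞} (hτ : IsTruncStoppingTime F τ) (t : ℝ≥0) :
    MeasurableSet[F t] {ω | (t : ℝ≥0∞) ≤ τ ω} := by
  have h := hτ t (measurableSet_Ici (a := (t : ℝ≥0∞)))
  convert! h using 1
  ext ω
  simp

namespace IsDriftlessSubordinator

variable {Ω : Type*} [mΩ : MeasurableSpace Ω] {P : Measure Ω} {S : ℝ≥0 → Ω → ℝ} {ν : Measure ℝ}

/-- Finitely many past values are partial sums of increments between ordered times, all independent
of the increment after `t`. A π-system argument later extends this to the whole past. -/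
lemma indepFun_finset_increment (hS : IsDriftlessSubordinator S ν P) (t h : ℝ≥0)
    (I : Finset (Iic t)) :
    IndepFun (fun ω (u : I) => S u ω) (fun ω => S (t + h) ω - S t ω) P := by
  -- Including 0 lets the values telescope from S_0 = 0; including `t` makes the last increment
  -- exactly the one over (t, t + h].
  set G : Finset ℝ≥0 := insert 0 (insert t (I.image Subtype.val)) with hG
  have hGt : ∀ u ∈ G, u ≤ t := by
    intro u hu
    simp only [hG, Finset.mem_insert, Finset.mem_image] at hu
    rcases hu with rfl | rfl | ⟨v, _, rfl⟩
    · exact zero_le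
    · exact le_rfl
    · exact v.2
  have h0G : 0 ∈ G := by simp [hG]
  have htG : t ∈ G := by simp [hG]
  obtain ⟨m, hm⟩ : ∃ m, G.card = m + 1 :=
    Nat.exists_eq_succ_of_ne_zero (Finset.card_ne_zero_of_mem h0G)
  set e := G.orderEmbOfFin hm
  have he0 : e ⟨0, m.succ_pos⟩ = 0 := by
    rw [Finset.orderEmbOfFin_zero hm m.succ_pos]
    exact le_antisymm (Finset.min'_le _ _ h0G) zero_le
  have hem : e ⟨m, m.lt_succ_self⟩ = t := by
    have := Finset.orderEmbOfFin_last hm m.succ_pos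
    simp only [Nat.add_sub_cancel] at this
    rw [this]
    exact le_antisymm (Finset.max'_le _ _ _ hGt) (Finset.le_max' _ _ htG)
  set tt : ℕ → ℝ≥0 := fun i => if hi : i < m + 1 then e ⟨i, hi⟩ else t + h with htt
  have htt1 : ∀ i (hi : i < m + 1), tt i = e ⟨i, hi⟩ := fun i hi => dif_pos hi
  have htt2 : tt (m + 1) = t + h := dif_neg (lt_irrefl _)
  have hmono : Monotone tt := by
    intro i j hij
    simp only [htt]
    split_ifs with hi hj hj
    · exact e.monotone hij
    · exact (hGt _ (Finset.orderEmbOfFin_mem _ hm _)).trans le_self_add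
    · omega
    · exact le_rfl
  have hind := (hS.indep.nat hmono).indepFun_finset (Finset.range m) {m} (by simp)
    fun i => (hS.measurable _).sub (hS.measurable _)
  have hj : ∀ u : I, ∃ j, j ≤ m ∧ tt j = u := by
    intro u
    have hu : (u : ℝ≥0) ∈ Set.range e := by
      rw [Finset.range_orderEmbOfFin]
      refine Finset.mem_coe.2 (Finset.mem_insert_of_mem (Finset.mem_insert_of_mem ?_))
      exact Finset.mem_image_of_mem _ u.2
    obtain ⟨⟨j, hj⟩, hju⟩ := hu
    exact ⟨j, Nat.lt_succ_iff.1 hj, by rw [htt1 j hj, hju]⟩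
  choose j hjm hju using hj
  have hleft : Measurable fun (v : Finset.range m → ℝ) (u : I) =>
      ∑ i : Finset.range m, if (i : ℕ) < j u then v i else 0 := by
    refine measurable_pi_lambda _ fun u => Finset.measurable_sum _ fun i _ => ?_
    split_ifs
    · exact measurable_pi_apply i
    · exact measurable_const
  have hright : Measurable fun v : ({m} : Finset ℕ) → ℝ => v ⟨m, Finset.mem_singleton_self m⟩ :=
    measurable_pi_apply _
  have hcomp := hind.comp hleft hright
  refine hcomp.congr ?_ ?_
  · filter_upwards [hS.start_zero] with ω hω
    ext u
    simp only [Function.comp]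
    rw [Finset.sum_coe_sort (Finset.range m)
      (fun i => if i < j u then S (tt (i + 1)) ω - S (tt i) ω else 0), ← Finset.sum_filter]
    have : (Finset.range m).filter (fun i => i < j u) = Finset.range (j u) := by
      ext i
      simp only [Finset.mem_filter, Finset.mem_range]
      have := hjm u
      omega
    rw [this, Finset.sum_range_sub (fun i => S (tt i) ω), hju, htt1 0 m.succ_pos, he0, hω, sub_zero]
  · refine Eventually.of_forall fun ω => ?_
    simp only [Function.comp]
    rw [htt2, htt1 m m.lt_succ_self, hem]

variable [IsProbabilityMeasure P]

/-- The increment after time `t` is independent of the past up to `t`. -/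
lemma measure_inter_increment (hS : IsDriftlessSubordinator S ν P) {t : ℝ≥0} {A : Set Ω}
    (hA : MeasurableSet[hS.filtration t] A) (h : ℝ≥0) (x : ℝ) :
    P (A ∩ {ω | x ≤ S (t + h) ω - S t ω}) = P A * P {ω | x ≤ S h ω} := by
  have h1 : IndepFun (fun ω (u : Iic t) => S u ω) (fun ω => S (t + h) ω - S t ω) P :=
    IndepFun.process_indepFun (X := fun (u : Iic t) ω => S u ω) (fun u => hS.measurable u)
      ((hS.measurable _).sub (hS.measurable _)) fun I => hS.indepFun_finset_increment t h I
  rw [filtration, Filtration.natural_eq_comap] at hA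
  obtain ⟨B, hB, rfl⟩ := hA
  have h2 := h1.measure_inter_preimage_eq_mul B (Ici x) hB measurableSet_Ici
  have h3 := (hS.stationary t h).measure_mem_eq (s := Ici x) measurableSet_Ici
  rw [h3] at h2
  exact h2

/-- Wald's argument: whether an interval is started by time τ is known at its left endpoint, hence
independent of the increment over it. At most 2^n τ + 1 intervals are started. -/
lemma lintegral_encard_gridJumps_le (hS : IsDriftlessSubordinator S ν P) {τ : Ω → ℝ≥0∞}
    (hτ : IsTruncStoppingTime hS.filtration τ) (x : ℝ) (n : ℕ) :
    ∫⁻ ω, ((gridJumps (S · ω) x (τ ω) n).encard : ℝ≥0∞) ∂P ≤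
      (2 ^ n * ∫⁻ ω, τ ω ∂P + 1) * P {ω | x ≤ S (2 ^ n)⁻¹ ω} := by
  have hm := hτ.measurable
  have h1 := lintegral_encard_setOf (P := P) (measurableSet_gridJump hS.measurable hm x n)
  have h2 := lintegral_encard_setOf (P := P) (A := fun k => {ω | (dyadicPt n k : ℝ≥0∞) ≤ τ ω})
    fun k => measurableSet_le measurable_const hm
  calc ∫⁻ ω, ((gridJumps (S · ω) x (τ ω) n).encard : ℝ≥0∞) ∂P
      = ∑' k, P {ω | (dyadicPt n k : ℝ≥0∞) ≤ τ ω ∧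
          x ≤ S (dyadicPt n (k + 1)) ω - S (dyadicPt n k) ω} := h1
    _ = ∑' k, P {ω | (dyadicPt n k : ℝ≥0∞) ≤ τ ω} * P {ω | x ≤ S (2 ^ n)⁻¹ ω} := by
        refine tsum_congr fun k => ?_
        rw [← hS.measure_inter_increment (hτ.measurableSet_ge _), ← dyadicPt_succ]
        rfl
    _ = (∫⁻ ω, ({k | (dyadicPt n k : ℝ≥0∞) ≤ τ ω}.encard : ℝ≥0∞) ∂P) *
          P {ω | x ≤ S (2 ^ n)⁻¹ ω} := by
        rw [ENNReal.tsum_mul_right, ← h2]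
        rfl
    _ ≤ (∫⁻ ω, (2 ^ n * τ ω + 1) ∂P) * P {ω | x ≤ S (2 ^ n)⁻¹ ω} := by
        gcongr
        exact encard_dyadicPt_le _ _
    _ = _ := by
        rw [lintegral_add_right _ measurable_const, lintegral_const_mul _ hm]
        simp

/-- A bound for the mean number of jumps of size at least `x` up to an integrable stopping time. -/
lemma lintegral_encard_jumpTimes_le (hS : IsDriftlessSubordinator S ν P) {τ : Ω → ℝ≥0∞}
    (hτ : IsTruncStoppingTime hS.filtration τ) (hτ' : ∫⁻ ω, τ ω ∂P < ∞) {x : ℝ} (hx : 0 < x) :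
    ∫⁻ ω, ((jumpTimes (S · ω) x (τ ω)).encard : ℝ≥0∞) ∂P ≤ ν (Ici x) * ∫⁻ ω, τ ω ∂P := by
  have hfatou : ∫⁻ ω, ((jumpTimes (S · ω) x (τ ω)).encard : ℝ≥0∞) ∂P ≤
      liminf (fun n => ∫⁻ ω, ((gridJumps (S · ω) x (τ ω) n).encard : ℝ≥0∞) ∂P) atTop := by
    refine le_trans (le_of_eq ?_) (lintegral_liminf_le
      fun n => measurable_encard_gridJumps hS.measurable hτ.measurable x n)
    refine lintegral_congr_ae ?_
    filter_upwards [hS.ae_isSubordinatorPath, ae_lt_top hτ.measurable hτ'.ne] with ω hω hωτ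
    exact (tendsto_encard_gridJumps hω.mono hω.rightCont hx hωτ.ne).liminf_eq.symm
  have hν := (hS.levyMeasure.measure_Ici_lt_top hx).ne
  obtain ⟨E, hE⟩ : ∃ E : ℝ≥0, ∫⁻ ω, τ ω ∂P = E := ⟨_, (ENNReal.coe_toNNReal hτ'.ne).symm⟩
  rw [hE]
  -- The rates are controlled only by numbers strictly above the tail, so `r` decreases to the tail
  -- at the end. The term r·2^{-n} comes from the one extra interval.
  have key : ∀ r : ℝ, ν.real (Ici x) < r →
      ∫⁻ ω, ((jumpTimes (S · ω) x (τ ω)).encard : ℝ≥0∞) ∂P ≤ ENNReal.ofReal (r * E) := by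
    intro r hr
    have hr0 : 0 ≤ r := measureReal_nonneg.trans hr.le
    refine hfatou.trans ?_
    have hbound : ∀ᶠ n : ℕ in atTop,
        ∫⁻ ω, ((gridJumps (S · ω) x (τ ω) n).encard : ℝ≥0∞) ∂P ≤
          ENNReal.ofReal (r * E + r * (((2 : ℝ≥0) ^ n)⁻¹ : ℝ≥0)) := by
      filter_upwards [hS.eventually_two_pow_mul_le hx hr] with n hn
      refine (hS.lintegral_encard_gridJumps_le hτ x n).trans ?_
      rw [hE, ← ofReal_measureReal (measure_ne_top P _), ← ENNReal.ofReal_coe_nnreal,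
        show (2 : ℝ≥0∞) ^ n = ENNReal.ofReal (2 ^ n) by
          rw [ENNReal.ofReal_pow zero_le_two, ENNReal.ofReal_ofNat],
        ← ENNReal.ofReal_one, ← ENNReal.ofReal_mul (by positivity),
        ← ENNReal.ofReal_add (by positivity) zero_le_one, ← ENNReal.ofReal_mul (by positivity)]
      refine ENNReal.ofReal_le_ofReal ?_
      have h2 : (((2 : ℝ≥0) ^ n)⁻¹ : ℝ≥0) = ((2 : ℝ) ^ n)⁻¹ := by push_cast; rfl
      rw [h2]
      have h3 : P.real {ω | x ≤ S (2 ^ n)⁻¹ ω} ≤ r * ((2 : ℝ) ^ n)⁻¹ := by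
        rw [← div_eq_mul_inv, le_div_iff₀ (by positivity)]
        linarith
      have h4 := mul_le_mul_of_nonneg_right hn E.coe_nonneg
      linarith
    have hlim : Tendsto (fun n : ℕ => ENNReal.ofReal (r * E + r * (((2 : ℝ≥0) ^ n)⁻¹ : ℝ≥0))) atTop
        (𝓝 (ENNReal.ofReal (r * E))) := by
      refine ENNReal.tendsto_ofReal ?_
      have := ((NNReal.tendsto_coe.2 tendsto_two_pow_inv).const_mul r).const_add (r * E)
      simpa using this
    exact (liminf_le_liminf hbound).trans hlim.liminf_eq.le
  rw [← ofReal_measureReal hν, ← ENNReal.ofReal_coe_nnreal, ← ENNReal.ofReal_mul measureReal_nonneg]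
  have hlim : Tendsto (fun r : ℝ => ENNReal.ofReal (r * E)) (𝓝[>] ν.real (Ici x))
      (𝓝 (ENNReal.ofReal (ν.real (Ici x) * E))) := by
    refine ENNReal.tendsto_ofReal ?_
    exact ((continuous_mul_const (E : ℝ)).tendsto _).mono_left nhdsWithin_le_nhds
  refine ge_of_tendsto hlim ?_
  filter_upwards [self_mem_nhdsWithin] with r hr using key r hr

end IsDriftlessSubordinator

/-! ### Second moments and the strong law along sequences of levels. -/

lemma ncard_gridJumps_eq_sum (s : ℝ≥0 → ℝ) (x : ℝ) (t : ℝ≥0) (n : ℕ) :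
    ((gridJumps s x t n).ncard : ℝ) = ∑ k ∈ Finset.range (⌊t * 2 ^ n⌋₊ + 1),
      (Ici x).indicator 1 (s (dyadicPt n (k + 1)) - s (dyadicPt n k)) := by
  classical
  have h1 : gridJumps s x t n = ((Finset.range (⌊t * 2 ^ n⌋₊ + 1)).filter
      fun k => x ≤ s (dyadicPt n (k + 1)) - s (dyadicPt n k) : Finset ℕ) := by
    ext k
    have h2 : dyadicPt n k ≤ t ↔ k ≤ ⌊t * 2 ^ n⌋₊ := by
      rw [dyadicPt, div_le_iff₀ (by positivity), Nat.le_floor_iff zero_le]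
    simp [gridJumps, h2]
  rw [h1, ncard_coe_finset, ← Finset.sum_boole]
  refine Finset.sum_congr rfl fun k _ => ?_
  simp [indicator_apply]

namespace IsDriftlessSubordinator

variable {Ω : Type*} [mΩ : MeasurableSpace Ω] {P : Measure Ω} {S : ℝ≥0 → Ω → ℝ} {ν : Measure ℝ}

lemma aemeasurable_ncard_jumpTimes (hS : IsDriftlessSubordinator S ν P) {τ : Ω → ℝ≥0∞}
    (hτ : Measurable τ) (hτ' : ∀ᵐ ω ∂P, τ ω ≠ ∞) {x : ℝ} (hx : 0 < x) :
    AEMeasurable (fun ω => ((jumpTimes (S · ω) x (τ ω)).ncard : ℝ)) P := by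
  have := (aemeasurable_encard_jumpTimes hS.measurable hS.mono hS.rightCont hτ hτ' hx).ennreal_toReal
  simpa only [toReal_encard] using this

variable [IsProbabilityMeasure P]

/-- The count is a sum of independent indicators with a common mean, and the variance of an
indicator is at most its mean. -/
lemma lintegral_sq_gridJumps_le (hS : IsDriftlessSubordinator S ν P) (x : ℝ) (t : ℝ≥0) (n : ℕ) :
    ∫⁻ ω, ENNReal.ofReal ((((gridJumps (S · ω) x t n).ncard : ℝ) -
      (⌊t * 2 ^ n⌋₊ + 1 : ℕ) * P.real {ω | x ≤ S (2 ^ n)⁻¹ ω}) ^ 2) ∂P ≤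
      ENNReal.ofReal ((⌊t * 2 ^ n⌋₊ + 1 : ℕ) * P.real {ω | x ≤ S (2 ^ n)⁻¹ ω}) := by
  set m := ⌊t * 2 ^ n⌋₊ + 1
  set p := P.real {ω | x ≤ S (2 ^ n)⁻¹ ω} with hp
  set g : ℝ → ℝ := (Ici x).indicator 1 with hg
  have hgm : Measurable g := measurable_one.indicator measurableSet_Ici
  set Y : ℕ → Ω → ℝ := fun k ω => S (dyadicPt n (k + 1)) ω - S (dyadicPt n k) ω with hY
  have hYm : ∀ k, Measurable (Y k) := fun k => (hS.measurable _).sub (hS.measurable _)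
  set X : ℕ → Ω → ℝ := fun k => g ∘ Y k with hX
  have hXm : ∀ k, Measurable (X k) := fun k => hgm.comp (hYm k)
  have hg01 : ∀ y, ‖g y‖ ≤ 1 := by
    intro y
    simp only [hg, indicator_apply]
    split_ifs <;> simp
  have hX2 : ∀ k, MemLp (X k) 2 P := fun k =>
    MemLp.of_bound (hXm k).aestronglyMeasurable 1 (Eventually.of_forall fun ω => hg01 _)
  have hEX : ∀ k, ∫ ω, X k ω ∂P = p := by
    intro k
    have h1 : X k = (Y k ⁻¹' Ici x).indicator 1 := rfl
    have h2 := (hS.stationary (dyadicPt n k) (2 ^ n)⁻¹).measure_mem_eq (s := Ici x)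
      measurableSet_Ici
    rw [← dyadicPt_succ] at h2
    rw [h1, integral_indicator_one ((hYm k) measurableSet_Ici), measureReal_def, hp,
      measureReal_def]
    exact congrArg ENNReal.toReal h2
  have hind : iIndepFun X P := (hS.indep.nat (dyadicPt_mono n)).comp (fun _ => g) fun _ => hgm
  have hvar : ∀ k, Var[X k; P] ≤ p := by
    intro k
    refine (variance_le_expectation_sq (hXm k).aestronglyMeasurable).trans (le_of_eq ?_)
    rw [← hEX k]
    refine integral_congr_ae (Eventually.of_forall fun ω => ?_)
    simp only [Pi.pow_apply, hX, Function.comp, hg, indicator_apply]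
    split_ifs <;> simp
  have hsum : ∀ ω, ((gridJumps (S · ω) x t n).ncard : ℝ) = (∑ k ∈ Finset.range m, X k) ω := by
    intro ω
    rw [ncard_gridJumps_eq_sum, Finset.sum_apply]
    rfl
  have hmem : MemLp (∑ k ∈ Finset.range m, X k) 2 P := memLp_finsetSum' _ fun k _ => hX2 k
  have hEsum : ∫ ω, (∑ k ∈ Finset.range m, X k) ω ∂P = m * p := by
    simp_rw [Finset.sum_apply]
    rw [integral_finsetSum _ fun k _ => (hX2 k).integrable one_le_two]
    simp [hEX]
  have hvarsum : Var[∑ k ∈ Finset.range m, X k; P] ≤ m * p := by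
    rw [IndepFun.variance_sum (fun k _ => hX2 k) fun i _ j _ hij => hind.indepFun hij]
    refine (Finset.sum_le_sum fun k _ => hvar k).trans ?_
    simp
  rw [variance_eq_integral hmem.1.aemeasurable, hEsum] at hvarsum
  simp_rw [hsum]
  rw [← ofReal_integral_eq_lintegral_ofReal]
  · exact ENNReal.ofReal_le_ofReal hvarsum
  · exact (hmem.sub (memLp_const _)).integrable_sq
  · exact Eventually.of_forall fun ω => sq_nonneg _

/-- The number of jumps of size at least `x` up to time `t` has mean square distance at most
`t ν[x, ∞)` from `t ν[x, ∞)`. -/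
lemma lintegral_sq_jumpTimes_le (hS : IsDriftlessSubordinator S ν P) {x : ℝ} (hx : 0 < x)
    (hc : ContinuousAt (fun y => ν (Ici y)) x) (t : ℝ≥0) :
    ∫⁻ ω, ENNReal.ofReal ((((jumpTimes (S · ω) x t).ncard : ℝ) - t * ν.real (Ici x)) ^ 2) ∂P ≤
      ENNReal.ofReal (t * ν.real (Ici x)) := by
  have hmean : Tendsto (fun n : ℕ => ((⌊t * 2 ^ n⌋₊ + 1 : ℕ) : ℝ) *
      P.real {ω | x ≤ S (2 ^ n)⁻¹ ω}) atTop (𝓝 (t * ν.real (Ici x))) := by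
    have hpow : Tendsto (fun n : ℕ => (2 : ℝ) ^ n) atTop atTop :=
      tendsto_pow_atTop_atTop_of_one_lt one_lt_two
    have h1 := ((tendsto_nat_floor_mul_div_atTop t.coe_nonneg).comp hpow).add
      (tendsto_inv_atTop_zero.comp hpow)
    rw [add_zero] at h1
    refine (h1.mul (hS.tendsto_two_pow_mul hx hc)).congr fun n => ?_
    have h2 : ⌊(t : ℝ) * 2 ^ n⌋₊ = ⌊t * 2 ^ n⌋₊ := by
      rw [Nat.floor_eq_iff (by positivity)]
      have h3 : ((⌊t * 2 ^ n⌋₊ : ℕ) : ℝ≥0) ≤ t * 2 ^ n := Nat.floor_le zero_le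
      have h4 : t * 2 ^ n < ((⌊t * 2 ^ n⌋₊ : ℕ) : ℝ≥0) + 1 := Nat.lt_floor_add_one _
      exact ⟨by exact_mod_cast h3, by exact_mod_cast h4⟩
    simp only [Function.comp, h2]
    push_cast
    field_simp
  have hmeas : ∀ n, Measurable fun ω => ENNReal.ofReal ((((gridJumps (S · ω) x t n).ncard : ℝ) -
      (⌊t * 2 ^ n⌋₊ + 1 : ℕ) * P.real {ω | x ≤ S (2 ^ n)⁻¹ ω}) ^ 2) := by
    intro n
    have h1 := (measurable_encard_gridJumps hS.measurable (measurable_const (a := (t : ℝ≥0∞))) x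
      n).ennreal_toReal
    simp_rw [toReal_encard] at h1
    exact ((h1.sub_const _).pow_const 2).ennreal_ofReal
  -- Both the grid counts and their means converge, so Fatou carries the variance bound to the
  -- limit.
  calc _ = ∫⁻ ω, liminf (fun n : ℕ => ENNReal.ofReal ((((gridJumps (S · ω) x t n).ncard : ℝ) -
      (⌊t * 2 ^ n⌋₊ + 1 : ℕ) * P.real {ω | x ≤ S (2 ^ n)⁻¹ ω}) ^ 2)) atTop ∂P := by
        refine lintegral_congr_ae ?_
        filter_upwards [hS.ae_isSubordinatorPath] with ω hω
        refine (Tendsto.liminf_eq (ENNReal.tendsto_ofReal ((Tendsto.sub ?_ hmean).pow 2))).symm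
        refine tendsto_const_nhds.congr' ?_
        filter_upwards [eventually_encard_gridJumps hω.mono hω.rightCont hx t] with n hn
        simp only [ncard, hn]
    _ ≤ _ := lintegral_liminf_le hmeas
    _ ≤ liminf (fun n : ℕ => ENNReal.ofReal ((⌊t * 2 ^ n⌋₊ + 1 : ℕ) *
          P.real {ω | x ≤ S (2 ^ n)⁻¹ ω})) atTop :=
        liminf_le_liminf (Eventually.of_forall fun n => hS.lintegral_sq_gridJumps_le x t n)
    _ = _ := (ENNReal.tendsto_ofReal hmean).liminf_eq

/-- The strong law of large numbers along a sequence of continuity points with summable inverse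
tails. -/
lemma ae_tendsto_ncard_jumpTimes_of_summable (hS : IsDriftlessSubordinator S ν P) {x : ℕ → ℝ}
    (hx : ∀ k, 0 < x k) (hc : ∀ k, ContinuousAt (fun y => ν (Ici y)) (x k))
    (hsum : Summable fun k => (ν.real (Ici (x k)))⁻¹) (hpos : ∀ᶠ k in atTop, 0 < ν.real (Ici (x k)))
    (t : ℝ≥0) :
    ∀ᵐ ω ∂P, Tendsto (fun k => ((jumpTimes (S · ω) (x k) t).ncard : ℝ) / ν.real (Ici (x k))) atTop
      (𝓝 t) := by
  set F := fun k => ν.real (Ici (x k)) with hF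
  have hF0 : ∀ k, 0 ≤ F k := fun k => measureReal_nonneg
  -- Squared relative errors, with means at most t/ν[x_k,∞). Their sum has finite mean, hence is
  -- almost surely finite, and the terms tend to 0.
  set Z : ℕ → Ω → ℝ≥0∞ := fun k ω =>
    ENNReal.ofReal ((((jumpTimes (S · ω) (x k) t).ncard : ℝ) - t * F k) ^ 2) *
      ENNReal.ofReal (((F k)⁻¹) ^ 2) with hZ
  have hZm : ∀ k, AEMeasurable (Z k) P := fun k =>
    ((((hS.aemeasurable_ncard_jumpTimes (measurable_const (a := (t : ℝ≥0∞)))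
      (by simp) (hx k)).sub_const _).pow_const 2).ennreal_ofReal).mul_const _
  have hZle : ∀ k, ∫⁻ ω, Z k ω ∂P ≤ ENNReal.ofReal (t * (F k)⁻¹) := by
    intro k
    simp only [hZ]
    rw [lintegral_mul_const' _ _ ENNReal.ofReal_ne_top]
    refine (mul_le_mul_left (hS.lintegral_sq_jumpTimes_le (hx k) (hc k) t) _).trans ?_
    rw [← ENNReal.ofReal_mul (by positivity)]
    refine ENNReal.ofReal_le_ofReal (le_of_eq ?_)
    rcases (hF0 k).eq_or_lt with h | h
    · have h' : ν.real (Ici (x k)) = 0 := h.symm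
      simp [hF, h']
    · have h' : ν.real (Ici (x k)) ≠ 0 := h.ne'
      simp only [hF]
      field_simp
  have hfin : ∫⁻ ω, ∑' k, Z k ω ∂P ≠ ∞ := by
    rw [lintegral_tsum hZm]
    refine ((ENNReal.tsum_le_tsum hZle).trans_lt ?_).ne
    rw [← ENNReal.ofReal_tsum_of_nonneg (fun k => mul_nonneg t.coe_nonneg (inv_nonneg.2 (hF0 k)))
      (hsum.mul_left _)]
    exact ENNReal.ofReal_lt_top
  filter_upwards [ae_lt_top' (AEMeasurable.tsum hZm) hfin] with ω hω
  have h1 := ENNReal.tendsto_atTop_zero_of_tsum_ne_top hω.ne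
  have h2 := (ENNReal.tendsto_toReal ENNReal.zero_ne_top).comp h1
  have h3 := (Real.continuous_sqrt.tendsto _).comp h2
  rw [ENNReal.toReal_zero, Real.sqrt_zero] at h3
  rw [tendsto_iff_norm_sub_tendsto_zero]
  refine h3.congr' ?_
  filter_upwards [hpos] with k hk
  simp only [Function.comp, hZ]
  rw [← ENNReal.ofReal_mul (by positivity), ENNReal.toReal_ofReal (by positivity), ← mul_pow,
    Real.sqrt_sq_eq_abs, Real.norm_eq_abs]
  congr 1
  simp only [hF]
  field_simp

end IsDriftlessSubordinator

/-! ### From geometric sequences to all levels and all times. -/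

lemma exists_pos_forall_mul_pow_notMem {B : Set ℝ} (hB : B.Countable) {y : ℝ} (hy : 0 < y) :
    ∃ θ, 0 < θ ∧ ∀ k : ℕ, θ * y ^ k ∉ B := by
  have h1 : (⋃ k : ℕ, (fun b => b / y ^ k) '' B).Countable :=
    countable_iUnion fun k => hB.image _
  obtain ⟨θ, hθ, h0, -⟩ := (h1.dense_compl ℝ).exists_between (zero_lt_one (α := ℝ))
  refine ⟨θ, h0, fun k hk => hθ (mem_iUnion.2 ⟨k, _, hk, ?_⟩)⟩
  field_simp

lemma tendsto_mul_pow_nhdsGT {θ y : ℝ} (hθ : 0 < θ) (hy0 : 0 < y) (hy1 : y < 1) :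
    Tendsto (fun k : ℕ => θ * y ^ k) atTop (𝓝[>] 0) :=
  (tendsto_const_mul_nhdsGT hθ).comp (tendsto_nhdsWithin_iff.2
    ⟨tendsto_pow_atTop_nhds_zero_of_lt_one hy0.le hy1,
      Eventually.of_forall fun k => pow_pos hy0 k⟩)

/-- As `x ↓ 0`, `x` lies between two consecutive terms of the geometric sequence `θ y ^ k` with
large indices. -/
lemma eventually_exists_mem_geometric {θ y : ℝ} (hθ : 0 < θ) (hy0 : 0 < y) (hy1 : y < 1)
    {Q : ℕ → Prop} (hQ : ∀ᶠ k in atTop, Q k) :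
    ∀ᶠ x in 𝓝[>] (0 : ℝ), ∃ k, Q k ∧ θ * y ^ (k + 1) < x ∧ x ≤ θ * y ^ k := by
  obtain ⟨K, hK⟩ := eventually_atTop.1 hQ
  have hpos : 0 < θ * y ^ K := by positivity
  filter_upwards [Ioo_mem_nhdsGT hpos] with x hx
  have hyK : y ^ K ≤ 1 := pow_le_one₀ hy0.le hy1.le
  have hx1 : x / θ ≤ 1 := by
    rw [div_le_one hθ]
    nlinarith [hx.2]
  obtain ⟨k, hk1, hk2⟩ := exists_nat_pow_near_of_lt_one (div_pos hx.1 hθ) hx1 hy0 hy1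
  rw [lt_div_iff₀ hθ] at hk1
  rw [div_le_iff₀ hθ] at hk2
  refine ⟨k, hK k ?_, by linarith, by linarith⟩
  have h1 : y ^ (k + 1) < y ^ K := by
    have := hx.2
    by_contra hcon
    have := mul_le_mul_of_nonneg_right (not_lt.1 hcon) hθ.le
    linarith
  have := (pow_lt_pow_iff_right_of_lt_one₀ hy0 hy1).1 h1
  omega

/-- Convergence of the ratio of two monotone functions along sufficiently dense geometric sequences
implies convergence. -/
lemma tendsto_div_of_geometric {N ψ : ℝ → ℝ} {α t δ : ℝ} (hN0 : ∀ x, 0 ≤ N x)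
    (hN : ∀ x x', 0 < x → x ≤ x' → N x' ≤ N x) (hδ : 0 < δ) (hψ0 : ∀ x, 0 < x → x < δ → 0 < ψ x)
    (hψ : ∀ x x', 0 < x → x ≤ x' → x' < δ → ψ x' ≤ ψ x)
    (hratio : ∀ c, 0 < c → Tendsto (fun x => ψ (c * x) / ψ x) (𝓝[>] 0) (𝓝 (c ^ (-α))))
    {y : ℕ → ℝ} (hy : ∀ j, y j ∈ Ioo (0 : ℝ) 1) (hy1 : Tendsto y atTop (𝓝 1))
    (hseq : ∀ j, ∃ θ, 0 < θ ∧
      Tendsto (fun k : ℕ => N (θ * y j ^ k) / ψ (θ * y j ^ k)) atTop (𝓝 t)) :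
    Tendsto (fun x => N x / ψ x) (𝓝[>] 0) (𝓝 t) := by
  have hpow : ∀ β : ℝ, Tendsto (fun j => t * y j ^ β) atTop (𝓝 t) := by
    intro β
    have := (((Real.continuousAt_rpow_const 1 β (Or.inl one_ne_zero)).tendsto.comp hy1).const_mul t)
    simpa using this
  have hsmall : ∀ {θ : ℝ} (_ : 0 < θ) (j : ℕ), ∀ᶠ k : ℕ in atTop, θ * y j ^ k < δ ∧
      θ * y j ^ (k + 1) < δ := by
    intro θ hθ j
    have h1 := tendsto_mul_pow_nhdsGT hθ (hy j).1 (hy j).2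
    have h2 : ∀ᶠ k : ℕ in atTop, θ * y j ^ k < δ :=
      (tendsto_nhdsWithin_iff.1 h1).1.eventually_lt_const hδ
    exact h2.and ((tendsto_add_atTop_nat 1).eventually h2)
  have hpos : ∀ {θ : ℝ} (_ : 0 < θ) (j k : ℕ), 0 < θ * y j ^ k := fun hθ j k =>
    mul_pos hθ (pow_pos (hy j).1 k)
  refine tendsto_order.2 ⟨fun r hr => ?_, fun r hr => ?_⟩
  -- For x between consecutive terms, monotonicity bounds N(x)/ψ(x) below by N at the larger term
  -- over ψ at the smaller one, which tends to t·y^α. A ratio y near 1 keeps this above `r`; the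
  -- upper bound is symmetric, with y^{-α}.
  · obtain ⟨j, hj⟩ := ((hpow α).eventually_const_lt hr).exists
    obtain ⟨θ, hθ, hlim⟩ := hseq j
    have h1 := (hratio _ (hy j).1).comp (tendsto_mul_pow_nhdsGT hθ (hy j).1 (hy j).2)
    have h2 := hlim.div h1 (Real.rpow_pos_of_pos (hy j).1 _).ne'
    rw [Real.rpow_neg (hy j).1.le, div_inv_eq_mul] at h2
    filter_upwards [eventually_exists_mem_geometric hθ (hy j).1 (hy j).2
      ((h2.eventually_const_lt hj).and (hsmall hθ j))] with x ⟨k, ⟨hk, hk1, hk2⟩, hx1, hx2⟩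
    have hx0 := (hpos hθ j (k + 1)).trans hx1
    have hψx := hψ0 x hx0 (hx2.trans_lt hk1)
    have e1 := hψ0 _ (hpos hθ j k) hk1
    have e2 := hψ0 _ (hpos hθ j (k + 1)) hk2
    refine hk.trans_le ?_
    have hmul : y j * (θ * y j ^ k) = θ * y j ^ (k + 1) := by ring
    simp only [Function.comp, Pi.div_apply, hmul]
    rw [div_div_div_cancel_right₀ e1.ne']
    exact div_le_div₀ (hN0 _) (hN _ _ hx0 hx2) hψx
      (hψ _ _ (hpos hθ j (k + 1)) hx1.le (hx2.trans_lt hk1))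
  · obtain ⟨j, hj⟩ := ((hpow (-α)).eventually_lt_const hr).exists
    obtain ⟨θ, hθ, hlim⟩ := hseq j
    have h1 := (hratio _ (hy j).1).comp (tendsto_mul_pow_nhdsGT hθ (hy j).1 (hy j).2)
    have h2 := (hlim.comp (tendsto_add_atTop_nat 1)).mul h1
    filter_upwards [eventually_exists_mem_geometric hθ (hy j).1 (hy j).2
      ((h2.eventually_lt_const hj).and (hsmall hθ j))] with x ⟨k, ⟨hk, hk1, hk2⟩, hx1, hx2⟩
    have hx0 := (hpos hθ j (k + 1)).trans hx1
    have e1 := hψ0 _ (hpos hθ j k) hk1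
    have e2 := hψ0 _ (hpos hθ j (k + 1)) hk2
    refine lt_of_le_of_lt ?_ hk
    have hmul : y j * (θ * y j ^ k) = θ * y j ^ (k + 1) := by ring
    simp only [Function.comp, hmul]
    rw [div_mul_div_cancel₀ e2.ne']
    exact div_le_div₀ (hN0 _) (hN _ _ (hpos hθ j (k + 1)) hx1.le) e1
      (hψ _ _ hx0 hx2 hk1)

lemma antitone_measure_Ici (ν : Measure ℝ) : Antitone fun y => ν (Ici y) :=
  fun _ _ h => measure_mono (Ici_subset_Ici.2 h)

lemma RegVaryingTail.exists_scaling_eq {ν : Measure ℝ} {α : ℝ} {l : ℝ → ℝ}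
    (hν : RegVaryingTail ν α l) :
    ∃ δ, 0 < δ ∧ ∀ x, 0 < x → x < δ → 0 < scaling α l x ∧ ν (Ici x) = ENNReal.ofReal (scaling α l x) := by
  obtain ⟨δ, hδ, h⟩ := mem_nhdsGT_iff_exists_Ioo_subset.1
    ((hν.1.eventually_scaling_pos α).and hν.2)
  exact ⟨δ, hδ, fun x h0 h1 => h ⟨h0, h1⟩⟩

lemma jumpTimes_anti (s : ℝ≥0 → ℝ) (T : ℝ≥0∞) {x x' : ℝ} (h : x ≤ x') :
    jumpTimes s x' T ⊆ jumpTimes s x T :=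
  fun _ hu => ⟨hu.1, h.trans hu.2⟩

namespace IsDriftlessSubordinator

variable {Ω : Type*} [mΩ : MeasurableSpace Ω] {P : Measure Ω} [IsProbabilityMeasure P]
  {S : ℝ≥0 → Ω → ℝ} {ν : Measure ℝ} {α : ℝ} {l : ℝ → ℝ}

/-- The inverse tails at θy^k have successive ratios tending to y^α < 1, hence are summable; this is
where α > 0 enters the strong law. The scale θ is chosen so that every θy^k avoids the countably
many discontinuities of the tail. -/
lemma exists_ae_tendsto_geometric (hS : IsDriftlessSubordinator S ν P) (hα : 0 < α)
    (hν : RegVaryingTail ν α l) {y : ℝ} (hy0 : 0 < y) (hy1 : y < 1) (t : ℝ≥0) :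
    ∃ θ, 0 < θ ∧ ∀ᵐ ω ∂P, Tendsto (fun k : ℕ =>
      ((jumpTimes (S · ω) (θ * y ^ k) t).ncard : ℝ) / scaling α l (θ * y ^ k)) atTop (𝓝 t) := by
  obtain ⟨θ, hθ, hc⟩ := exists_pos_forall_mul_pow_notMem
    (antitone_measure_Ici ν).countable_not_continuousAt hy0
  have hx := tendsto_mul_pow_nhdsGT hθ hy0 hy1
  have hF : ∀ᶠ k : ℕ in atTop, ν.real (Ici (θ * y ^ k)) = scaling α l (θ * y ^ k) ∧
      0 < scaling α l (θ * y ^ k) := by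
    filter_upwards [hx.eventually hν.2, hx.eventually (hν.1.eventually_scaling_pos α)] with k h1 h2
    rw [measureReal_def, h1, ENNReal.toReal_ofReal h2.le]
    exact ⟨rfl, h2⟩
  refine ⟨θ, hθ, ?_⟩
  have hsum : Summable fun k : ℕ => (ν.real (Ici (θ * y ^ k)))⁻¹ := by
    refine summable_of_ratio_test_tendsto_lt_one (l := y ^ α) (Real.rpow_lt_one hy0.le hy1 hα)
      (hF.mono fun k hk => ?_) ?_
    · rw [hk.1]
      exact inv_ne_zero hk.2.ne'
    · have h1 := (hν.1.tendsto_scaling_div α hy0).comp hx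
      have h2 := h1.inv₀ (Real.rpow_pos_of_pos hy0 _).ne'
      rw [Real.rpow_neg hy0.le, inv_inv] at h2
      refine h2.congr' ?_
      filter_upwards [hF, (tendsto_add_atTop_nat 1).eventually hF] with k hk hk'
      have hmul : y * (θ * y ^ k) = θ * y ^ (k + 1) := by ring
      simp only [Function.comp, hmul]
      rw [hk.1, hk'.1, norm_inv, norm_inv, Real.norm_of_nonneg hk.2.le,
        Real.norm_of_nonneg hk'.2.le, inv_div, inv_div_inv]
  have h := hS.ae_tendsto_ncard_jumpTimes_of_summable (x := fun k => θ * y ^ k)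
    (fun k => by positivity) (fun k => not_not.1 (hc k)) hsum
    (hF.mono fun k hk => by rw [hk.1]; exact hk.2) t
  filter_upwards [h] with ω hω
  refine hω.congr' ?_
  filter_upwards [hF] with k hk
  rw [hk.1]

lemma ae_tendsto_ncard_jumpTimes_const (hS : IsDriftlessSubordinator S ν P) (hα : 0 < α)
    (hν : RegVaryingTail ν α l) (t : ℝ≥0) :
    ∀ᵐ ω ∂P, Tendsto (fun x => ((jumpTimes (S · ω) x t).ncard : ℝ) / scaling α l x) (𝓝[>] 0)
      (𝓝 t) := by
  set y : ℕ → ℝ := fun j => 1 - 1 / ((j : ℝ) + 2) with hy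
  have hy01 : ∀ j, y j ∈ Ioo (0 : ℝ) 1 := by
    intro j
    have h1 : 0 < 1 / ((j : ℝ) + 2) := by positivity
    have h2 : 1 / ((j : ℝ) + 2) < 1 := by
      rw [div_lt_one (by positivity)]
      linarith [(Nat.cast_nonneg j : (0 : ℝ) ≤ j)]
    constructor <;> simp only [hy] <;> linarith
  have hy1 : Tendsto y atTop (𝓝 1) := by
    have h1 : Tendsto (fun j : ℕ => 1 / ((j : ℝ) + 2)) atTop (𝓝 0) :=
      tendsto_const_nhds.div_atTop (tendsto_atTop_add_const_right _ _ tendsto_natCast_atTop_atTop)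
    have h2 := h1.const_sub 1
    rwa [sub_zero] at h2
  choose θ hθ hlim using fun j => hS.exists_ae_tendsto_geometric hα hν (hy01 j).1 (hy01 j).2 t
  obtain ⟨δ, hδ, hψ⟩ := hν.exists_scaling_eq
  filter_upwards [ae_all_iff.2 hlim, hS.ae_isSubordinatorPath] with ω hω hpath
  refine tendsto_div_of_geometric (N := fun x => ((jumpTimes (S · ω) x t).ncard : ℝ))
    (fun x => Nat.cast_nonneg _) (fun x x' h0 h1 => ?_) hδ (fun x h0 h1 => (hψ x h0 h1).1)
    (fun x x' h0 h1 h2 => ?_) (fun c hc => hν.1.tendsto_scaling_div α hc) hy01 hy1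
    fun j => ⟨θ j, hθ j, hω j⟩
  · exact Nat.cast_le.2 (ncard_le_ncard (jumpTimes_anti _ _ h1) (finite_jumpTimes hpath.mono h0 t))
  · have h3 := antitone_measure_Ici ν h1
    simp only at h3
    rw [(hψ x h0 (h1.trans_lt h2)).2, (hψ x' (h0.trans_le h1) h2).2] at h3
    exact (ENNReal.ofReal_le_ofReal_iff (hψ x h0 (h1.trans_lt h2)).1.le).1 h3

/-- The strong law of large numbers for the number of small jumps, at all times simultaneously. -/
lemma ae_tendsto_ncard_jumpTimes (hS : IsDriftlessSubordinator S ν P) (hα : 0 < α)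
    (hν : RegVaryingTail ν α l) :
    ∀ᵐ ω ∂P, ∀ t : ℝ≥0, Tendsto (fun x => ((jumpTimes (S · ω) x t).ncard : ℝ) / scaling α l x)
      (𝓝[>] 0) (𝓝 t) := by
  -- Counts are monotone in time and the limit t is continuous, so a countable dense set of times
  -- suffices for a common null set.
  obtain ⟨D, hDc, hD⟩ := TopologicalSpace.exists_countable_dense ℝ≥0
  filter_upwards [(ae_ball_iff hDc).2 fun t _ => hS.ae_tendsto_ncard_jumpTimes_const hα hν t,
    hS.ae_isSubordinatorPath] with ω hω hpath t
  have hmono : ∀ {x : ℝ} (_ : 0 < x) {a b : ℝ≥0} (_ : a ≤ b),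
      ((jumpTimes (S · ω) x a).ncard : ℝ) ≤ (jumpTimes (S · ω) x b).ncard := by
    intro x hx a b hab
    refine Nat.cast_le.2 (ncard_le_ncard (fun u hu => ⟨hu.1.trans ?_, hu.2⟩)
      (finite_jumpTimes hpath.mono hx b))
    exact_mod_cast hab
  refine tendsto_order.2 ⟨fun r hr => ?_, fun r hr => ?_⟩
  · rcases lt_or_ge r 0 with h | h
    · filter_upwards [hν.1.eventually_scaling_pos α] with x hx
      exact h.trans_le (by positivity)
    · lift r to ℝ≥0 using h
      obtain ⟨q, hqD, hrq, hqt⟩ := hD.exists_between (NNReal.coe_lt_coe.1 hr)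
      filter_upwards [(hω q hqD).eventually_const_lt (NNReal.coe_lt_coe.2 hrq),
        hν.1.eventually_scaling_pos α, self_mem_nhdsWithin] with x h1 h2 h3
      exact h1.trans_le (div_le_div_of_nonneg_right (hmono h3 hqt.le) h2.le)
  · lift r to ℝ≥0 using t.coe_nonneg.trans hr.le
    obtain ⟨q, hqD, htq, hqr⟩ := hD.exists_between (NNReal.coe_lt_coe.1 hr)
    filter_upwards [(hω q hqD).eventually_lt_const (NNReal.coe_lt_coe.2 hqr),
      hν.1.eventually_scaling_pos α, self_mem_nhdsWithin] with x h1 h2 h3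
    exact (div_le_div_of_nonneg_right (hmono h3 htq.le) h2.le).trans_lt h1

end IsDriftlessSubordinator

/-! ### Convergence in the mean, and the theorem. -/

/-- A form of dominated convergence in the mean with varying bounds whose integrals converge. -/
lemma tendsto_integral_abs_sub_of_le {Ω ι : Type*} [MeasurableSpace Ω] {P : Measure Ω}
    {u : Filter ι} [u.IsCountablyGenerated] {X Y : ι → Ω → ℝ} {X' Y' : Ω → ℝ} {E : ι → ℝ}
    (hXm : ∀ᶠ i in u, AEStronglyMeasurable (X i) P) (hYi : ∀ᶠ i in u, Integrable (Y i) P)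
    (hX0 : ∀ᶠ i in u, ∀ᵐ ω ∂P, 0 ≤ X i ω) (hXY : ∀ᶠ i in u, ∀ᵐ ω ∂P, X i ω ≤ Y i ω)
    (hX' : Integrable X' P) (hY' : Integrable Y' P)
    (hXlim : ∀ᵐ ω ∂P, Tendsto (fun i => X i ω) u (𝓝 (X' ω)))
    (hYlim : ∀ᵐ ω ∂P, Tendsto (fun i => Y i ω) u (𝓝 (Y' ω)))
    (hYE : ∀ᶠ i in u, ∫ ω, Y i ω ∂P ≤ E i) (hE : Tendsto E u (𝓝 (∫ ω, Y' ω ∂P))) :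
    Tendsto (fun i => ∫ ω, |X i ω - X' ω| ∂P) u (𝓝 0) := by
  have hXi : ∀ᶠ i in u, Integrable (X i) P := by
    filter_upwards [hXm, hYi, hX0, hXY] with i h1 h2 h3 h4
    refine h2.mono' h1 ?_
    filter_upwards [h3, h4] with ω h5 h6
    rwa [Real.norm_of_nonneg h5]
  -- Scheffé's observation: for Z ≥ 0 the deficit (Z' − Z)⁺ is dominated by |Z'|. It is used for X
  -- and for Y − X.
  have key : ∀ {Z : ι → Ω → ℝ} {Z' : Ω → ℝ}, (∀ᶠ i in u, Integrable (Z i) P) → Integrable Z' P →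
      (∀ᶠ i in u, ∀ᵐ ω ∂P, 0 ≤ Z i ω) → (∀ᵐ ω ∂P, Tendsto (fun i => Z i ω) u (𝓝 (Z' ω))) →
      Tendsto (fun i => ∫ ω, max (Z' ω - Z i ω) 0 ∂P) u (𝓝 0) := by
    intro Z Z' h1 h2 h3 h4
    have h5 : ∫ ω, max (Z' ω - Z' ω) 0 ∂P = 0 := by simp
    suffices h6 : Tendsto (fun i => ∫ ω, max (Z' ω - Z i ω) 0 ∂P) u
        (𝓝 (∫ ω, max (Z' ω - Z' ω) 0 ∂P)) by rwa [h5] at h6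
    refine tendsto_integral_filter_of_dominated_convergence (fun ω => |Z' ω|) ?_ ?_ h2.abs ?_
    · filter_upwards [h1] with i hi
      exact (h2.sub hi).pos_part.aestronglyMeasurable
    · filter_upwards [h3] with i hi
      filter_upwards [hi] with ω hω
      rw [Real.norm_of_nonneg (le_max_right _ _)]
      exact max_le (by linarith [le_abs_self (Z' ω)]) (abs_nonneg _)
    · filter_upwards [h4] with ω hω
      exact (hω.const_sub _).max tendsto_const_nhds
  have hk1 := key hXi hX' hX0 hXlim
  have hk2 := key (Z := fun i ω => Y i ω - X i ω) (Z' := fun ω => Y' ω - X' ω)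
    (by filter_upwards [hYi, hXi] with i h1 h2 using h1.sub h2) (hY'.sub hX')
    (by
      filter_upwards [hXY] with i hi
      filter_upwards [hi] with ω hω using sub_nonneg.2 hω)
    (by filter_upwards [hXlim, hYlim] with ω h1 h2 using h2.sub h1)
  have hlim : Tendsto (fun i => E i - ∫ ω, Y' ω ∂P + ∫ ω, max (Y' ω - X' ω - (Y i ω - X i ω)) 0 ∂P +
      2 * ∫ ω, max (X' ω - X i ω) 0 ∂P) u (𝓝 0) := by
    have := ((hE.sub_const (∫ ω, Y' ω ∂P)).add hk2).add (hk1.const_mul 2)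
    simpa using this
  refine tendsto_of_tendsto_of_tendsto_of_le_of_le' tendsto_const_nhds hlim
    (Eventually.of_forall fun i => integral_nonneg fun ω => abs_nonneg _) ?_
  filter_upwards [hXi, hYi, hYE] with i h1 h2 h3
  have hi1 : Integrable (fun ω => max (Y' ω - X' ω - (Y i ω - X i ω)) 0) P :=
    ((hY'.sub hX').sub (h2.sub h1)).pos_part
  have hi2 : Integrable (fun ω => max (X' ω - X i ω) 0) P := (hX'.sub h1).pos_part
  -- Here |X − X'| = (X − X') + 2(X' − X)⁺, and X − X' = (Y − Y') + ((Y' − X') − (Y − X)) with the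
  -- last bracket replaced by its positive part. So only an upper bound on E Y is needed.
  have h4 : ∫ ω, |X i ω - X' ω| ∂P ≤ ∫ ω, (Y i ω - Y' ω +
      max (Y' ω - X' ω - (Y i ω - X i ω)) 0 + 2 * max (X' ω - X i ω) 0) ∂P := by
    refine integral_mono (h1.sub hX').abs (((h2.sub hY').add hi1).add (hi2.const_mul 2))
      fun ω => ?_
    have e1 := le_max_left (Y' ω - X' ω - (Y i ω - X i ω)) 0
    have e2 := le_max_right (Y' ω - X' ω - (Y i ω - X i ω)) 0
    have e3 := le_max_left (X' ω - X i ω) 0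
    have e4 := le_max_right (X' ω - X i ω) 0
    simp only
    rcases abs_cases (X i ω - X' ω) with ⟨h, _⟩ | ⟨h, _⟩ <;> rw [h] <;> linarith
  rw [integral_add (f := fun ω => Y i ω - Y' ω + max (Y' ω - X' ω - (Y i ω - X i ω)) 0)
    ((h2.sub hY').add hi1) (hi2.const_mul 2), integral_add (f := fun ω => Y i ω - Y' ω) (h2.sub hY') hi1, integral_sub h2 hY',
    integral_const_mul] at h4
  linarith

namespace IsSubordinatorPath

variable {s : ℝ≥0 → ℝ} {φ : ℝ → ℝ}

lemma gapCount_le (hs : IsSubordinatorPath s) (hφ : IsHalfLineDiffeo φ) {C : ℝ} (hC0 : 0 < C)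
    (hC : ∀ y, 0 ≤ y → halfLineDeriv φ y ≤ C) {x : ℝ} (hx : 0 < x) (T : ℝ≥0) :
    (gapCount φ s x T : ℝ) ≤ (jumpTimes s (C⁻¹ * x) T).ncard := by
  have h := jumpTimes_comp_sub_le hs hφ hx (zero_le (a := T)) hC0
    fun y hy => hC y ((hs.nonneg 0).trans hy.1)
  rw [jumpTimes_zero _ hx, jumpTimes_zero _ (mul_pos (inv_pos.2 hC0) hx)] at h
  simpa [gapCount] using h

lemma tendsto_ncard_jumpTimes_mul {α : ℝ} {l : ℝ → ℝ} (hl : SlowlyVarying l) {T : ℝ≥0}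
    (hN : Tendsto (fun x => ((jumpTimes s x T).ncard : ℝ) / scaling α l x) (𝓝[>] 0) (𝓝 T))
    {C : ℝ} (hC : 0 < C) :
    Tendsto (fun x => ((jumpTimes s (C⁻¹ * x) T).ncard : ℝ) / scaling α l x) (𝓝[>] 0)
      (𝓝 (C ^ α * T)) := by
  have h1 := (hN.comp (tendsto_const_mul_nhdsGT (inv_pos.2 hC))).mul
    (hl.tendsto_scaling_div α (inv_pos.2 hC))
  rw [Real.inv_rpow hC.le, Real.rpow_neg hC.le, inv_inv, mul_comm] at h1
  refine h1.congr' ?_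
  filter_upwards [(tendsto_const_mul_nhdsGT (inv_pos.2 hC)).eventually
    (hl.eventually_scaling_pos α)] with x hx
  simp only [Function.comp]
  rw [div_mul_div_cancel₀ hx.ne']

end IsSubordinatorPath

namespace IsDriftlessSubordinator

variable {Ω : Type*} [mΩ : MeasurableSpace Ω] {P : Measure Ω}
  {S : ℝ≥0 → Ω → ℝ} {ν : Measure ℝ} {τ : Ω → ℝ≥0∞}

lemma aemeasurable_gapCount (hS : IsDriftlessSubordinator S ν P) {φ : ℝ → ℝ}
    (hφ : IsHalfLineDiffeo φ) (hτ : Measurable τ) (hτ' : ∀ᵐ ω ∂P, τ ω ≠ ∞) {x : ℝ} (hx : 0 < x) :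
    AEMeasurable (fun ω => (gapCount φ (S · ω) x (τ ω) : ℝ)) P := by
  -- Nothing is known about φ on negative numbers; truncating changes nothing on almost every path.
  have hcont : Continuous fun y : ℝ => φ (max y 0) :=
    hφ.contDiffOn.continuousOn.comp_continuous (continuous_id.max continuous_const)
      fun y => mem_Ici.2 (le_max_right _ _)
  have heq : ∀ᵐ ω ∂P, (fun t => φ (max (S t ω) 0)) = fun t => φ (S t ω) := by
    filter_upwards [hS.ae_isSubordinatorPath] with ω hω
    ext t
    rw [max_eq_left (hω.nonneg t)]
  have h := (aemeasurable_encard_jumpTimes (P := P) (f := fun t ω => φ (max (S t ω) 0))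
    (fun t => hcont.measurable.comp (hS.measurable t))
    (by
      filter_upwards [heq, hS.ae_isSubordinatorPath] with ω h1 h2
      rw [h1]
      exact h2.mono_comp hφ)
    (by
      filter_upwards [heq, hS.ae_isSubordinatorPath] with ω h1 h2
      rw [h1]
      exact h2.rightCont_comp hφ) hτ hτ' hx).ennreal_toReal
  refine h.congr ?_
  filter_upwards [heq] with ω hω
  rw [toReal_encard, hω, gapCount]

variable [IsProbabilityMeasure P]

lemma integrable_ncard_jumpTimes (hS : IsDriftlessSubordinator S ν P)
    (hτ : IsTruncStoppingTime hS.filtration τ) (hτ' : ∫⁻ ω, τ ω ∂P < ∞) {x : ℝ} (hx : 0 < x) :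
    Integrable (fun ω => ((jumpTimes (S · ω) x (τ ω)).ncard : ℝ)) P ∧
      ∫ ω, ((jumpTimes (S · ω) x (τ ω)).ncard : ℝ) ∂P ≤ ν.real (Ici x) * (∫⁻ ω, τ ω ∂P).toReal := by
  have hfin : ∀ᵐ ω ∂P, τ ω ≠ ∞ := (ae_lt_top hτ.measurable hτ'.ne).mono fun _ h => h.ne
  have hle := hS.lintegral_encard_jumpTimes_le hτ hτ' hx
  have htop : ν (Ici x) * ∫⁻ ω, τ ω ∂P ≠ ∞ :=
    ENNReal.mul_ne_top (hS.levyMeasure.measure_Ici_lt_top hx).ne hτ'.ne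
  have hm := aemeasurable_encard_jumpTimes hS.measurable hS.mono hS.rightCont hτ.measurable hfin hx
  have h1 := integrable_toReal_of_lintegral_ne_top hm (hle.trans_lt htop.lt_top).ne
  have h2 := integral_toReal hm (ae_lt_top' hm (hle.trans_lt htop.lt_top).ne)
  simp only [toReal_encard] at h1 h2
  refine ⟨h1, ?_⟩
  rw [h2, measureReal_def, ← ENNReal.toReal_mul]
  exact ENNReal.toReal_mono htop hle

end IsDriftlessSubordinator

theorem corollary3p2 {Ω : Type*} [MeasurableSpace Ω] (P : Measure Ω) [IsProbabilityMeasure P]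
    (α : ℝ) (hα0 : 0 < α) (hα1 : α ≤ 1) (l : ℝ → ℝ) (ν : Measure ℝ)
    (hν : RegVaryingTail ν α l)
    (S : ℝ≥0 → Ω → ℝ) (hS : IsDriftlessSubordinator S ν P)
    (φ : ℝ → ℝ) (hφ : IsHalfLineDiffeo φ) (hφ' : BddAbove (halfLineDeriv φ '' Ici 0))
    (τ : Ω → ℝ≥0∞) (hτ : IsTruncStoppingTime hS.filtration τ) (hτ' : ∫⁻ ω, τ ω ∂P < ∞) :
    -- the gap counts are finite, and they and the limit are integrable
    (∀ᵐ ω ∂P, ∀ x : ℝ, 0 < x → (jumpTimes (fun u => φ (S u ω)) x (τ ω)).Finite) ∧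
    (∀ x : ℝ, 0 < x → Integrable (fun ω => (gapCount φ (S · ω) x (τ ω) : ℝ)) P) ∧
    (∀ᵐ ω ∂P, IntervalIntegrable (fun u => halfLineDeriv φ (S u.toNNReal ω) ^ α) volume
      0 (τ ω).toReal) ∧
    Integrable (fun ω => gapLimit φ α (S · ω) (τ ω)) P ∧
    -- almost sure convergence
    (∀ᵐ ω ∂P, Tendsto (fun x => (gapCount φ (S · ω) x (τ ω) : ℝ) / scaling α l x) (𝓝[>] 0)
      (𝓝 (gapLimit φ α (S · ω) (τ ω)))) ∧
    -- convergence in the mean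
    Tendsto (fun x => ∫ ω, |(gapCount φ (S · ω) x (τ ω) : ℝ) / scaling α l x
      - gapLimit φ α (S · ω) (τ ω)| ∂P) (𝓝[>] 0) (𝓝 0) := by
  have hτm := hτ.measurable
  have hτfin : ∀ᵐ ω ∂P, τ ω ≠ ∞ := (ae_lt_top hτm hτ'.ne).mono fun _ h => h.ne
  have hpath := hS.ae_isSubordinatorPath
  obtain ⟨C, hCbd⟩ := hφ'
  have hC : ∀ y, 0 ≤ y → halfLineDeriv φ y ≤ C := fun y hy => hCbd (mem_image_of_mem _ hy)
  have hC0 : 0 < C := (hφ.deriv_pos 0 le_rfl).trans_le (hC 0 le_rfl)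
  have hC1 : 0 < C⁻¹ := inv_pos.2 hC0
  have hlaw := hS.ae_tendsto_ncard_jumpTimes hα0 hν
  have hle : ∀ᵐ ω ∂P, ∀ x : ℝ, 0 < x → (gapCount φ (S · ω) x (τ ω) : ℝ) ≤
      (jumpTimes (S · ω) (C⁻¹ * x) (τ ω)).ncard := by
    filter_upwards [hpath, hτfin] with ω hω hT x hx
    rw [← ENNReal.coe_toNNReal hT]
    exact hω.gapCount_le hφ hC0 hC hx _
  have hint : ∀ x : ℝ, 0 < x → Integrable (fun ω => (gapCount φ (S · ω) x (τ ω) : ℝ)) P := by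
    intro x hx
    refine (hS.integrable_ncard_jumpTimes hτ hτ' (mul_pos hC1 hx)).1.mono'
      (hS.aemeasurable_gapCount hφ hτm hτfin hx).aestronglyMeasurable ?_
    filter_upwards [hle] with ω hω
    rw [Real.norm_of_nonneg (Nat.cast_nonneg _)]
    exact hω x hx
  have has : ∀ᵐ ω ∂P, Tendsto (fun x => (gapCount φ (S · ω) x (τ ω) : ℝ) / scaling α l x) (𝓝[>] 0)
      (𝓝 (gapLimit φ α (S · ω) (τ ω))) := by
    filter_upwards [hpath, hτfin, hlaw] with ω hω hT hN
    rw [← ENNReal.coe_toNNReal hT]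
    exact tendsto_gapCount_div hω hφ hα0 hν.1 hN _
  have hbd : ∀ᵐ ω ∂P, Tendsto (fun x => ((jumpTimes (S · ω) (C⁻¹ * x) (τ ω)).ncard : ℝ) /
      scaling α l x) (𝓝[>] 0) (𝓝 (C ^ α * (τ ω).toReal)) := by
    filter_upwards [hτfin, hlaw] with ω hT hN
    rw [← ENNReal.coe_toNNReal hT]
    exact IsSubordinatorPath.tendsto_ncard_jumpTimes_mul hν.1 (hN _) hC0
  have hτint : Integrable (fun ω => C ^ α * (τ ω).toReal) P :=
    (integrable_toReal_of_lintegral_ne_top hτm.aemeasurable hτ'.ne).const_mul _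
  have hlimint : Integrable (fun ω => gapLimit φ α (S · ω) (τ ω)) P := by
    -- The limit inherits measurability from the normalized counts along a sequence of levels, and
    -- the bound C^α τ from the dominating counts.
    have hseq : Tendsto (fun n : ℕ => 1 / ((n : ℝ) + 1)) atTop (𝓝[>] 0) :=
      tendsto_nhdsWithin_iff.2 ⟨tendsto_one_div_add_atTop_nhds_zero_nat,
        Eventually.of_forall fun n => mem_Ioi.2 Nat.one_div_pos_of_nat⟩
    have hm : AEStronglyMeasurable (fun ω => gapLimit φ α (S · ω) (τ ω)) P :=
      aestronglyMeasurable_of_tendsto_ae atTop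
        (f := fun (n : ℕ) ω => (gapCount φ (S · ω) (1 / ((n : ℝ) + 1)) (τ ω) : ℝ) /
          scaling α l (1 / ((n : ℝ) + 1)))
        (fun n => ((hint _ Nat.one_div_pos_of_nat).div_const _).aestronglyMeasurable)
        (by filter_upwards [has] with ω hω using hω.comp hseq)
    refine hτint.mono' hm ?_
    filter_upwards [has, hbd, hle] with ω h1 h2 h3
    have h0 : 0 ≤ gapLimit φ α (S · ω) (τ ω) := by
      refine ge_of_tendsto h1 ?_
      filter_upwards [hν.1.eventually_scaling_pos α] with x hx
      positivity
    rw [Real.norm_of_nonneg h0]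
    refine le_of_tendsto_of_tendsto h1 h2 ?_
    filter_upwards [hν.1.eventually_scaling_pos α, self_mem_nhdsWithin] with x hx hx0
    exact div_le_div_of_nonneg_right (h3 x hx0) hx.le
  refine ⟨?_, hint, ?_, hlimint, has, ?_⟩
  · filter_upwards [hpath, hτfin] with ω hω hT x hx
    rw [← ENNReal.coe_toNNReal hT]
    exact hω.finite_jumpTimes_comp hφ hx _
  · filter_upwards [hpath] with ω hω
    exact hω.intervalIntegrable hφ α _ _
  · refine tendsto_integral_abs_sub_of_le
      (X := fun x ω => (gapCount φ (S · ω) x (τ ω) : ℝ) / scaling α l x)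
      (Y := fun x ω => ((jumpTimes (S · ω) (C⁻¹ * x) (τ ω)).ncard : ℝ) / scaling α l x)
      (Y' := fun ω => C ^ α * (τ ω).toReal)
      -- The Wald bound at level x/C, normalized by ψ(x); it tends to C^α Eτ, the mean of the limit
      -- of the dominating variables.
      (E := fun x => scaling α l (C⁻¹ * x) / scaling α l x * (∫⁻ ω, τ ω ∂P).toReal)
      ?_ ?_ ?_ ?_ hlimint hτint has hbd ?_ ?_
    · filter_upwards [self_mem_nhdsWithin] with x hx
      exact ((hint x hx).div_const _).aestronglyMeasurable
    · filter_upwards [self_mem_nhdsWithin] with x hx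
      exact (hS.integrable_ncard_jumpTimes hτ hτ' (mul_pos hC1 hx)).1.div_const _
    · filter_upwards [hν.1.eventually_scaling_pos α] with x hx
      exact Eventually.of_forall fun ω => by positivity
    · filter_upwards [hν.1.eventually_scaling_pos α, self_mem_nhdsWithin] with x hx hx0
      filter_upwards [hle] with ω hω
      exact div_le_div_of_nonneg_right (hω x hx0) hx.le
    · have hmul := tendsto_const_mul_nhdsGT hC1
      filter_upwards [hν.1.eventually_scaling_pos α, self_mem_nhdsWithin,
        hmul.eventually (hν.1.eventually_scaling_pos α), hmul.eventually hν.2] with x hx hx0 hx1 hx2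
      have h := (hS.integrable_ncard_jumpTimes hτ hτ' (mul_pos hC1 hx0)).2
      rw [measureReal_def, hx2, ENNReal.toReal_ofReal hx1.le] at h
      rw [integral_div, div_mul_eq_mul_div]
      exact div_le_div_of_nonneg_right h hx.le
    · have h := (hν.1.tendsto_scaling_div α hC1).mul_const (∫⁻ ω, τ ω ∂P).toReal
      rw [Real.inv_rpow hC0.le, Real.rpow_neg hC0.le, inv_inv] at h
      rwa [integral_const_mul, integral_toReal hτm.aemeasurable (ae_lt_top hτm hτ'.ne)]
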